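/- Conventions. 2-categories, 2-functors, 2-natural transformations, 2-adjunctions and 2-monads are strict ($\mathrm{Cat}$-enriched); pullbacks and comma objects are the strict two-dimensional ones. A 2-functor is fully faithful if it is locally an isomorphism of categories. A right 2-adjoint is 2-premonadic (2-monadic) if its Eilenberg–Moore comparison 2-functor is fully faithful (a 2-equivalence). A 2-monad $(T,\mu,\eta)$ is idempotent if $\mu$ is invertible, and lax idempotent if there is an adjunction $\mu\dashv \eta T$ (in the 2-category of endo-2-functors, 2-natural transformations and modifications) with identity counit. A 2-adjunction is called idempotent or lax idempotent if the 2-monad it induces is. A right 2-adjoint $R$, with left 2-adjoint $L$, is full reflective if $L\dashv R$ is idempotent and $R$ is 2-monadic; it is pre-Kock–Zöberlein if $L\dashv R$ is lax idempotent and $R$ is 2-premonadic. For an object $x$ of a 2-category $\mathcal A$, the lax comma 2-category $\mathcal A//x$ has as objects the pairs $(w,\,a:w\to x)$, as morphisms $(w,a)\to(w',a')$ the pairs $(f:w\to w',\ \beta:a'f\Rightarrow a)$, and as 2-cells $(f,\beta)\Rightarrow(f',\beta')$ the 2-cells $\theta:f\Rightarrow f'$ with $\beta'\cdot(a'\ast\theta)=\beta$.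 The comma 2-category $\mathcal A/x$ is its locally full wide sub-2-category on the morphisms with $\beta$ an identity. A 2-functor $G:\mathcal A\to\mathcal B$ induces pointwise 2-functors $\check G:\mathcal A/x\to\mathcal B/G(x)$ and $\check G:\mathcal A//x\to\mathcal B//G(x)$. For a morphism $c:y\to z$ of $\mathcal B$, let $c^*:\mathcal B/z\to\mathcal B/y$ be the 2-functor given by pullback along $c$, and $c^{\Leftarrow}:\mathcal B//z\to\mathcal B/y$ the 2-functor given on objects by $(x,b)\mapsto(b\downarrow c\to y)$, where the comma object $b\downarrow c$ carries the universal 2-cell from the composite through $b$ to the composite through $c$. Theorem. Let $F\dashv G:\mathcal A\to\mathcal B$ be a 2-adjunction with unit $\eta$. Suppose that $\mathcal A$ has comma objects, and that $\mathcal B$ has pullbacks and comma objects along $\eta_y:y\to GF(y)$ for every object $y$ of $\mathcal B$. Suppose that $F\dashv G$ is admissible with respect to the basic fibration, that is, $G$ is fully faithful and for every $y\in\mathcal B$ the 2-functor $$\eta_y^*\circ\check G:\mathcal A/F(y)\to\mathcal B/y$$ is full reflective. Then $F\dashv G$ is 2-admissible, that is, $G$ is pre-Kock–Zöberlein and for every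 $y\in\mathcal B$ the 2-functor $$\eta_y^{\Leftarrow}\circ\check G:\mathcal A//F(y)\to\mathcal B/y$$ is pre-Kock–Zöberlein. -/

import Mathlib

open CategoryTheory Bicategory

/-!
Conventions. A 2-category is a bicategory with `Bicategory.Strict`, a 2-functor is a
`StrictPseudofunctor`. Composition of 1-cells is written in diagrammatic order `f ≫ g`, whiskering
is `f ◁ θ` and `θ ▷ g`. Equalities of 1-cells (for instance associativity) enter equations between
2-cells only through `eqToHom`, which is the identity 2-cell on equal 1-cells.
-/

universe w v u w₁ v₁ u₁

namespace TwoCat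


section Lemmas
variable {A : Type u} [Bicategory.{w, v} A]

lemma whiskerRight_congr {a b c : A} {f g : a ⟶ b} (θ : f ⟶ g) {h h' : b ⟶ c} (e : h = h') :
    θ ▷ h = eqToHom (by rw [e]) ≫ θ ▷ h' ≫ eqToHom (by rw [e]) := by
  subst e; simp

lemma whiskerLeft_congr {a b c : A} {f f' : a ⟶ b} (e : f = f') {g h : b ⟶ c} (θ : g ⟶ h) :
    f ◁ θ = eqToHom (by rw [e]) ≫ f' ◁ θ ≫ eqToHom (by rw [e]) := by
  subst e; simp

variable {B : Type u₁} [Bicategory.{w₁, v₁} B]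

lemma map₂_whiskerLeft_eq (F : StrictPseudofunctor A B) {a b c : A} (f : a ⟶ b) {g h : b ⟶ c}
    (θ : g ⟶ h) :
    F.map₂ (f ◁ θ) = eqToHom (F.map_comp f g) ≫ F.map f ◁ F.map₂ θ ≫
      eqToHom (F.map_comp f h).symm := by
  simp [F.mapComp_eq_eqToIso]

lemma map₂_whiskerRight_eq (F : StrictPseudofunctor A B) {a b c : A} {f g : a ⟶ b} (θ : f ⟶ g)
    (h : b ⟶ c) :
    F.map₂ (θ ▷ h) = eqToHom (F.map_comp f h) ≫ F.map₂ θ ▷ F.map h ≫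
      eqToHom (F.map_comp g h).symm := by
  simp [F.mapComp_eq_eqToIso]

end Lemmas

section LaxComma
variable {A : Type u} [Bicategory.{w, v} A]

/-- Objects `(w, a : w ⟶ y)` of the lax comma 2-category `A // y`. -/
structure LaxComma (y : A) where
  left : A
  hom : left ⟶ y

namespace LaxComma
variable {y : A}

/-- A morphism `(f, β) : (w, a) ⟶ (x, b)` of `A // y`: a morphism `f : w ⟶ x` with a 2-cell
`β : b · f ⟹ a`. -/
structure Hom (X Y : LaxComma y) where
  map : X.left ⟶ Y.left
  cell : map ≫ Y.hom ⟶ X.hom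

/-- A 2-cell `(f, β) ⟹ (f', β')` of `A // y`: a 2-cell `θ : f ⟹ f'` with `β' · (b ∗ θ) = β`. -/
@[ext]
structure Hom₂ {X Y : LaxComma y} (f g : Hom X Y) where
  cell : f.map ⟶ g.map
  w : cell ▷ Y.hom ≫ g.cell = f.cell

/-- Identities are `(id, id)`, and `(g, γ) ∘ (f, β) = (g · f, β · (γ ∗ f))`, up to the unitors and
associators, which are identities in a 2-category. -/
instance categoryStruct : CategoryStruct (LaxComma y) where
  Hom := Hom
  id X := ⟨𝟙 X.left, (λ_ X.hom).hom⟩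
  comp {_ _ Z} f g := ⟨f.map ≫ g.map, (α_ f.map g.map Z.hom).hom ≫ f.map ◁ g.cell ≫ f.cell⟩

@[simp] lemma id_map (X : LaxComma y) : Hom.map (𝟙 X) = 𝟙 X.left := rfl
@[simp] lemma id_cell (X : LaxComma y) : Hom.cell (𝟙 X) = (λ_ X.hom).hom := rfl
@[simp] lemma comp_map {X Y Z : LaxComma y} (f : X ⟶ Y) (g : Y ⟶ Z) :
    Hom.map (f ≫ g) = f.map ≫ g.map := rfl
@[simp] lemma comp_cell {X Y Z : LaxComma y} (f : X ⟶ Y) (g : Y ⟶ Z) :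
    Hom.cell (f ≫ g) = (α_ f.map g.map Z.hom).hom ≫ f.map ◁ g.cell ≫ f.cell := rfl

instance homCategory (X Y : LaxComma y) : Category (X ⟶ Y) where
  Hom := Hom₂
  id f := ⟨𝟙 f.map, by simp⟩
  comp θ φ := ⟨θ.cell ≫ φ.cell, by simp [φ.w, θ.w]⟩

@[ext]
lemma hom₂_ext {X Y : LaxComma y} {f g : X ⟶ Y} {θ φ : f ⟶ g} (h : θ.cell = φ.cell) : θ = φ :=
  Hom₂.ext h

@[simp] lemma id₂_cell {X Y : LaxComma y} (f : X ⟶ Y) : Hom₂.cell (𝟙 f) = 𝟙 f.map := rfl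
@[simp] lemma comp₂_cell {X Y : LaxComma y} {f g h : X ⟶ Y} (θ : f ⟶ g) (φ : g ⟶ h) :
    Hom₂.cell (θ ≫ φ) = θ.cell ≫ φ.cell := rfl

@[simps]
def mkIso {X Y : LaxComma y} {f g : X ⟶ Y} (e : f.map ≅ g.map)
    (h : e.hom ▷ Y.hom ≫ g.cell = f.cell) : f ≅ g where
  hom := ⟨e.hom, h⟩
  inv := ⟨e.inv, by simp [← h]⟩
  hom_inv_id := by ext; simp
  inv_hom_id := by ext; simp

def whiskerLeftHom {X Y Z : LaxComma y} (f : X ⟶ Y) {g h : Y ⟶ Z} (θ : g ⟶ h) :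
    f ≫ g ⟶ f ≫ h :=
  Hom₂.mk (f.map ◁ θ.cell) (by simp [← θ.w])

def whiskerRightHom {X Y Z : LaxComma y} {f g : X ⟶ Y} (θ : f ⟶ g) (h : Y ⟶ Z) :
    f ≫ h ⟶ g ≫ h :=
  Hom₂.mk (θ.cell ▷ h.map) (by simp [← θ.w, whisker_exchange_assoc])

@[simp] lemma whiskerLeftHom_cell {X Y Z : LaxComma y} (f : X ⟶ Y) {g h : Y ⟶ Z} (θ : g ⟶ h) :
    (whiskerLeftHom f θ).cell = f.map ◁ θ.cell := rfl
@[simp] lemma whiskerRightHom_cell {X Y Z : LaxComma y} {f g : X ⟶ Y} (θ : f ⟶ g) (h : Y ⟶ Z) :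
    (whiskerRightHom θ h).cell = θ.cell ▷ h.map := rfl

instance bicategory : Bicategory (LaxComma y) where
  homCategory := homCategory
  whiskerLeft f _ _ θ := whiskerLeftHom f θ
  whiskerRight θ h := whiskerRightHom θ h
  associator f g h := mkIso (α_ f.map g.map h.map) (by simp)
  leftUnitor f := mkIso (λ_ f.map) (by simp)
  rightUnitor f := mkIso (ρ_ f.map) (by simp)
  whisker_exchange := by intros; ext; simp [whisker_exchange]

@[simp] lemma whiskerLeft_cell {X Y Z : LaxComma y} (f : X ⟶ Y) {g h : Y ⟶ Z} (θ : g ⟶ h) :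
    Hom₂.cell (f ◁ θ) = f.map ◁ θ.cell := rfl
@[simp] lemma whiskerRight_cell {X Y Z : LaxComma y} {f g : X ⟶ Y} (θ : f ⟶ g) (h : Y ⟶ Z) :
    Hom₂.cell (θ ▷ h) = θ.cell ▷ h.map := rfl

lemma hom_ext [Strict A] {X Y : LaxComma y} {f g : X ⟶ Y} (h : f.map = g.map)
    (h' : f.cell = eqToHom (by rw [h]) ≫ g.cell) : f = g := by
  obtain ⟨f, a⟩ := f
  obtain ⟨g, b⟩ := g
  dsimp at h
  subst h
  simp at h'
  rw [h']

@[simp] lemma eqToHom_cell {X Y : LaxComma y} {f g : X ⟶ Y} (h : f = g) :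
    Hom₂.cell (eqToHom h) = eqToHom (congrArg Hom.map h) := by
  subst h; rfl

instance [Strict A] : Strict (LaxComma y) where
  id_comp f := hom_ext (Strict.id_comp _) (by simp [Strict.leftUnitor_eqToIso, Strict.associator_eqToIso])
  comp_id f := hom_ext (Strict.comp_id _) (by simp [Strict.rightUnitor_eqToIso])
  assoc f g h := hom_ext (Strict.assoc _ _ _) (by simp [Strict.associator_eqToIso])
  leftUnitor_eqToIso f := by ext; simp; exact congrArg Iso.hom (Strict.leftUnitor_eqToIso f.map)
  rightUnitor_eqToIso f := by ext; simp; exact congrArg Iso.hom (Strict.rightUnitor_eqToIso f.map)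
  associator_eqToIso f g h := by ext; simp; exact congrArg Iso.hom (Strict.associator_eqToIso f.map g.map h.map)

end LaxComma
end LaxComma

section StrictComma
variable {A : Type u} [Bicategory.{w, v} A]

/-- Objects `(w, a : w ⟶ y)` of the strict comma 2-category `A / y`, the locally full wide
sub-2-category of `A // y` on the morphisms `(f, β)` with `β` an identity. -/
structure StrictComma (y : A) where
  left : A
  hom : left ⟶ y

namespace StrictComma
variable {y : A}

/-- A morphism of `A / y`: a morphism `f` with `b · f = a`. -/
@[ext]
structure Hom (X Y : StrictComma y) where
  map : X.left ⟶ Y.left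
  w : map ≫ Y.hom = X.hom

/-- A 2-cell of `A / y` is a 2-cell of `A // y` between strict morphisms: this is the condition of
`LaxComma.Hom₂` for the identity 2-cells `b · f = a` and `b · f' = a`. -/
@[ext]
structure Hom₂ {X Y : StrictComma y} (f g : Hom X Y) where
  cell : f.map ⟶ g.map
  w : cell ▷ Y.hom ≫ eqToHom g.w = eqToHom f.w

variable [Strict A]

instance categoryStruct : CategoryStruct (StrictComma y) where
  Hom := Hom
  id X := ⟨𝟙 X.left, Strict.id_comp _⟩
  comp f g := ⟨f.map ≫ g.map, by rw [Strict.assoc, g.w, f.w]⟩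

@[simp] lemma id_map (X : StrictComma y) : Hom.map (𝟙 X) = 𝟙 X.left := rfl
@[simp] lemma comp_map {X Y Z : StrictComma y} (f : X ⟶ Y) (g : Y ⟶ Z) :
    Hom.map (f ≫ g) = f.map ≫ g.map := rfl

instance homCategory (X Y : StrictComma y) : Category (X ⟶ Y) where
  Hom := Hom₂
  id f := ⟨𝟙 f.map, by simp⟩
  comp θ φ := ⟨θ.cell ≫ φ.cell, by simp [φ.w, θ.w]⟩

@[ext]
lemma hom_ext {X Y : StrictComma y} {f g : X ⟶ Y} (h : f.map = g.map) : f = g :=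
  Hom.ext h

@[ext]
lemma hom₂_ext {X Y : StrictComma y} {f g : X ⟶ Y} {θ φ : f ⟶ g} (h : θ.cell = φ.cell) :
    θ = φ :=
  Hom₂.ext h

@[simp] lemma id₂_cell {X Y : StrictComma y} (f : X ⟶ Y) : Hom₂.cell (𝟙 f) = 𝟙 f.map := rfl
@[simp] lemma comp₂_cell {X Y : StrictComma y} {f g h : X ⟶ Y} (θ : f ⟶ g) (φ : g ⟶ h) :
    Hom₂.cell (θ ≫ φ) = θ.cell ≫ φ.cell := rfl

lemma whiskerRight_w {X Y : StrictComma y} {f g : X ⟶ Y} (θ : f ⟶ g) :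
    θ.cell ▷ Y.hom = eqToHom (f.w.trans g.w.symm) := by
  rw [← cancel_mono (eqToHom g.w), θ.w, eqToHom_trans]

def homMk₂ {X Y : StrictComma y} {f g : X ⟶ Y} (θ : f.map ⟶ g.map)
    (h : θ ▷ Y.hom = eqToHom (f.w.trans g.w.symm)) : f ⟶ g :=
  Hom₂.mk θ (by simp [h])

@[simp] lemma homMk₂_cell {X Y : StrictComma y} {f g : X ⟶ Y} (θ : f.map ⟶ g.map)
    (h : θ ▷ Y.hom = eqToHom (f.w.trans g.w.symm)) : (homMk₂ θ h).cell = θ := rfl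

@[simps]
def mkIso {X Y : StrictComma y} {f g : X ⟶ Y} (e : f.map = g.map) : f ≅ g where
  hom := homMk₂ (eqToHom e) (by simp)
  inv := homMk₂ (eqToHom e.symm) (by simp)
  hom_inv_id := by ext; simp
  inv_hom_id := by ext; simp

def whiskerLeftHom {X Y Z : StrictComma y} (f : X ⟶ Y) {g h : Y ⟶ Z} (θ : g ⟶ h) :
    f ≫ g ⟶ f ≫ h :=
  homMk₂ (f.map ◁ θ.cell) (by simp [whiskerRight_w, Strict.associator_eqToIso])

def whiskerRightHom {X Y Z : StrictComma y} {f g : X ⟶ Y} (θ : f ⟶ g) (h : Y ⟶ Z) :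
    f ≫ h ⟶ g ≫ h :=
  homMk₂ (θ.cell ▷ h.map) (by
    have e := whiskerRight_congr θ.cell h.w
    simp only [Bicategory.whiskerRight_comp, Strict.associator_eqToIso, eqToIso.inv, eqToIso.hom,
      eqToHom_comp_iff, comp_eqToHom_iff, whiskerRight_w] at e
    simp [e])

@[simp] lemma whiskerLeftHom_cell {X Y Z : StrictComma y} (f : X ⟶ Y) {g h : Y ⟶ Z}
    (θ : g ⟶ h) : (whiskerLeftHom f θ).cell = f.map ◁ θ.cell := rfl
@[simp] lemma whiskerRightHom_cell {X Y Z : StrictComma y} {f g : X ⟶ Y} (θ : f ⟶ g)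
    (h : Y ⟶ Z) : (whiskerRightHom θ h).cell = θ.cell ▷ h.map := rfl

attribute [local simp] Strict.leftUnitor_eqToIso Strict.rightUnitor_eqToIso
  Strict.associator_eqToIso in
instance bicategory : Bicategory (StrictComma y) where
  homCategory := homCategory
  whiskerLeft f _ _ θ := whiskerLeftHom f θ
  whiskerRight θ h := whiskerRightHom θ h
  associator f g h := mkIso (Strict.assoc f.map g.map h.map)
  leftUnitor f := mkIso (Strict.id_comp f.map)
  rightUnitor f := mkIso (Strict.comp_id f.map)
  whisker_exchange := by intros; ext; simp [whisker_exchange]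

@[simp] lemma whiskerLeft_cell {X Y Z : StrictComma y} (f : X ⟶ Y) {g h : Y ⟶ Z} (θ : g ⟶ h) :
    Hom₂.cell (f ◁ θ) = f.map ◁ θ.cell := rfl
@[simp] lemma whiskerRight_cell {X Y Z : StrictComma y} {f g : X ⟶ Y} (θ : f ⟶ g) (h : Y ⟶ Z) :
    Hom₂.cell (θ ▷ h) = θ.cell ▷ h.map := rfl

@[simp] lemma eqToHom_cell {X Y : StrictComma y} {f g : X ⟶ Y} (h : f = g) :
    Hom₂.cell (eqToHom h) = eqToHom (congrArg Hom.map h) := by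
  subst h; rfl

instance : Strict (StrictComma y) where
  id_comp f := hom_ext (Strict.id_comp _)
  comp_id f := hom_ext (Strict.comp_id _)
  assoc f g h := hom_ext (Strict.assoc _ _ _)
  leftUnitor_eqToIso f := by ext; simp; rfl
  rightUnitor_eqToIso f := by ext; simp; rfl
  associator_eqToIso f g h := by ext; simp; rfl

end StrictComma
end StrictComma

section Adjunctions

variable {A : Type u} [Bicategory.{w, v} A] {B : Type u₁} [Bicategory.{w₁, v₁} B]

/-- A (strict) 2-natural transformation between 2-functors. -/
structure TwoNatTrans (F G : StrictPseudofunctor A B) where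
  app (a : A) : F.obj a ⟶ G.obj a
  naturality {a b : A} (f : a ⟶ b) : F.map f ≫ app b = app a ≫ G.map f
  naturality₂ {a b : A} {f g : a ⟶ b} (θ : f ⟶ g) :
    F.map₂ θ ▷ app b =
      eqToHom (naturality f) ≫ app a ◁ G.map₂ θ ≫ eqToHom (naturality g).symm

/-- Invertibility of a 2-natural transformation. -/
def TwoNatTrans.IsInvertible {F G : StrictPseudofunctor A B} (α : TwoNatTrans F G) : Prop :=
  ∃ β : TwoNatTrans G F, ∀ a, α.app a ≫ β.app a = 𝟙 _ ∧ β.app a ≫ α.app a = 𝟙 _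

/-- A 2-functor is fully faithful if it is locally an isomorphism of categories, that is, bijective
on 1-cells and on 2-cells. -/
def IsFullyFaithful (F : StrictPseudofunctor A B) : Prop :=
  ∀ a b : A, Function.Bijective (fun f : a ⟶ b => F.map f) ∧
    ∀ f g : a ⟶ b, Function.Bijective (fun θ : f ⟶ g => F.map₂ θ)

/-- An equivalence in the 2-category of 2-categories, 2-functors and 2-natural transformations. -/
def IsTwoEquivalence (F : StrictPseudofunctor A B) : Prop :=
  ∃ (G : StrictPseudofunctor B A)
    (α : TwoNatTrans (StrictPseudofunctor.id A) (F.comp G))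
    (β : TwoNatTrans (G.comp F) (StrictPseudofunctor.id B)),
    α.IsInvertible ∧ β.IsInvertible

variable (B) in
/-- A (strict) 2-monad on `B`. -/
structure TwoMonad where
  T : StrictPseudofunctor B B
  unit : TwoNatTrans (StrictPseudofunctor.id B) T
  mult : TwoNatTrans (T.comp T) T
  map_unit_mult (x : B) : T.map (unit.app x) ≫ mult.app x = 𝟙 (T.obj x)
  unit_mult (x : B) : unit.app (T.obj x) ≫ mult.app x = 𝟙 (T.obj x)
  assoc (x : B) : T.map (mult.app x) ≫ mult.app x = mult.app (T.obj x) ≫ mult.app x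

namespace TwoMonad
variable (M : TwoMonad B)

/-- The component of the unit at `x`. -/
def unitApp (x : B) : x ⟶ M.T.obj x := M.unit.app x
/-- The component of the multiplication at `x`. -/
def multApp (x : B) : M.T.obj (M.T.obj x) ⟶ M.T.obj x := M.mult.app x

lemma unitApp_naturality {x y : B} (f : x ⟶ y) : f ≫ M.unitApp y = M.unitApp x ≫ M.T.map f :=
  M.unit.naturality f

lemma multApp_naturality {x y : B} (f : x ⟶ y) :
    M.T.map (M.T.map f) ≫ M.multApp y = M.multApp x ≫ M.T.map f :=
  M.mult.naturality f

lemma unitApp_multApp (x : B) : M.unitApp (M.T.obj x) ≫ M.multApp x = 𝟙 _ := M.unit_mult x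

/-- A 2-monad is idempotent if its multiplication is invertible. -/
def IsIdempotent : Prop := M.mult.IsInvertible

variable [Strict B]

/-- A 2-monad is lax idempotent if there is an adjunction `μ ⊣ η T` with identity counit: a
modification `Γ : id ⟹ (η T) · μ` (the unit of the adjunction) such that both triangle identities
hold. -/
def IsLaxIdempotent : Prop :=
  ∃ Γ : ∀ x : B, 𝟙 (M.T.obj (M.T.obj x)) ⟶ M.multApp x ≫ M.unitApp (M.T.obj x),
    (∀ {x y : B} (f : x ⟶ y),
      Γ x ▷ M.T.map (M.T.map f) =
        eqToHom (by rw [Strict.id_comp, Strict.comp_id]) ≫ M.T.map (M.T.map f) ◁ Γ y ≫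
          eqToHom (by
            rw [← Strict.assoc, multApp_naturality, Strict.assoc, unitApp_naturality, ← Strict.assoc])) ∧
    (∀ x : B, M.unitApp (M.T.obj x) ◁ Γ x =
      eqToHom (by rw [Strict.comp_id, ← Strict.assoc, unitApp_multApp, Strict.id_comp])) ∧
    (∀ x : B, Γ x ▷ M.multApp x =
      eqToHom (by rw [Strict.id_comp, Strict.assoc, unitApp_multApp, Strict.comp_id]))

/-- Strict algebras of a 2-monad. -/
structure Algebra where
  carrier : B
  str : M.T.obj carrier ⟶ carrier
  unit_str : M.unitApp carrier ≫ str = 𝟙 carrier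
  map_str : M.T.map str ≫ str = M.multApp carrier ≫ str

namespace Algebra
variable {M}

/-- Strict morphisms of algebras. -/
@[ext]
structure Hom (X Y : M.Algebra) where
  map : X.carrier ⟶ Y.carrier
  w : M.T.map map ≫ Y.str = X.str ≫ map

/-- Algebra 2-cells. -/
@[ext]
structure Hom₂ {X Y : M.Algebra} (f g : Hom X Y) where
  cell : f.map ⟶ g.map
  w : M.T.map₂ cell ▷ Y.str = eqToHom f.w ≫ X.str ◁ cell ≫ eqToHom g.w.symm

instance categoryStruct : CategoryStruct M.Algebra where
  Hom := Hom
  id X := ⟨𝟙 X.carrier, by rw [M.T.map_id, Strict.id_comp, Strict.comp_id]⟩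
  comp f g := ⟨f.map ≫ g.map, by
    rw [M.T.map_comp, Strict.assoc, g.w, ← Strict.assoc, f.w, Strict.assoc]⟩

@[simp] lemma id_map (X : M.Algebra) : Hom.map (𝟙 X) = 𝟙 X.carrier := rfl
@[simp] lemma comp_map {X Y Z : M.Algebra} (f : X ⟶ Y) (g : Y ⟶ Z) :
    Hom.map (f ≫ g) = f.map ≫ g.map := rfl

instance homCategory (X Y : M.Algebra) : Category (X ⟶ Y) where
  Hom := Hom₂
  id f := ⟨𝟙 f.map, by simp⟩
  comp θ φ := ⟨θ.cell ≫ φ.cell, by simp [φ.w, θ.w]⟩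

@[ext]
lemma hom_ext {X Y : M.Algebra} {f g : X ⟶ Y} (h : f.map = g.map) : f = g :=
  Hom.ext h

@[ext]
lemma hom₂_ext {X Y : M.Algebra} {f g : X ⟶ Y} {θ φ : f ⟶ g} (h : θ.cell = φ.cell) :
    θ = φ :=
  Hom₂.ext h

@[simp] lemma id₂_cell {X Y : M.Algebra} (f : X ⟶ Y) : Hom₂.cell (𝟙 f) = 𝟙 f.map := rfl
@[simp] lemma comp₂_cell {X Y : M.Algebra} {f g h : X ⟶ Y} (θ : f ⟶ g) (φ : g ⟶ h) :
    Hom₂.cell (θ ≫ φ) = θ.cell ≫ φ.cell := rfl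

@[simps]
def mkIso {X Y : M.Algebra} {f g : X ⟶ Y} (e : f.map = g.map) : f ≅ g where
  hom := Hom₂.mk (eqToHom e) (by simp [PrelaxFunctor.map₂_eqToHom])
  inv := Hom₂.mk (eqToHom e.symm) (by simp [PrelaxFunctor.map₂_eqToHom])
  hom_inv_id := by ext; simp
  inv_hom_id := by ext; simp

def whiskerLeftHom {X Y Z : M.Algebra} (f : X ⟶ Y) {g h : Y ⟶ Z} (θ : g ⟶ h) :
    f ≫ g ⟶ f ≫ h :=
  Hom₂.mk (f.map ◁ θ.cell) (by
    have e := whiskerLeft_congr f.w θ.cell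
    simp only [Bicategory.comp_whiskerLeft, Strict.associator_eqToIso, eqToIso.inv, eqToIso.hom,
      eqToHom_comp_iff, comp_eqToHom_iff, Category.assoc] at e
    simp [Strict.associator_eqToIso, M.T.mapComp_eq_eqToIso, θ.w, e])

def whiskerRightHom {X Y Z : M.Algebra} {f g : X ⟶ Y} (θ : f ⟶ g) (h : Y ⟶ Z) :
    f ≫ h ⟶ g ≫ h :=
  Hom₂.mk (θ.cell ▷ h.map) (by
    have e := whiskerRight_congr (M.T.map₂ θ.cell) h.w
    simp only [Bicategory.whiskerRight_comp, Strict.associator_eqToIso, eqToIso.inv, eqToIso.hom,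
      eqToHom_comp_iff, comp_eqToHom_iff, Category.assoc, θ.w] at e
    simp [Strict.associator_eqToIso, M.T.mapComp_eq_eqToIso, e])

@[simp] lemma whiskerLeftHom_cell {X Y Z : M.Algebra} (f : X ⟶ Y) {g h : Y ⟶ Z}
    (θ : g ⟶ h) : (whiskerLeftHom f θ).cell = f.map ◁ θ.cell := rfl
@[simp] lemma whiskerRightHom_cell {X Y Z : M.Algebra} {f g : X ⟶ Y} (θ : f ⟶ g)
    (h : Y ⟶ Z) : (whiskerRightHom θ h).cell = θ.cell ▷ h.map := rfl

attribute [local simp] Strict.leftUnitor_eqToIso Strict.rightUnitor_eqToIso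
  Strict.associator_eqToIso in
instance bicategory : Bicategory M.Algebra where
  homCategory := homCategory
  whiskerLeft f _ _ θ := whiskerLeftHom f θ
  whiskerRight θ h := whiskerRightHom θ h
  associator f g h := mkIso (Strict.assoc f.map g.map h.map)
  leftUnitor f := mkIso (Strict.id_comp f.map)
  rightUnitor f := mkIso (Strict.comp_id f.map)
  whisker_exchange := by intros; ext; simp [whisker_exchange]

@[simp] lemma whiskerLeft_cell {X Y Z : M.Algebra} (f : X ⟶ Y) {g h : Y ⟶ Z} (θ : g ⟶ h) :
    Hom₂.cell (f ◁ θ) = f.map ◁ θ.cell := rfl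
@[simp] lemma whiskerRight_cell {X Y Z : M.Algebra} {f g : X ⟶ Y} (θ : f ⟶ g) (h : Y ⟶ Z) :
    Hom₂.cell (θ ▷ h) = θ.cell ▷ h.map := rfl

@[simp] lemma eqToHom_cell {X Y : M.Algebra} {f g : X ⟶ Y} (h : f = g) :
    Hom₂.cell (eqToHom h) = eqToHom (congrArg Hom.map h) := by
  subst h; rfl

instance : Strict M.Algebra where
  id_comp f := hom_ext (Strict.id_comp _)
  comp_id f := hom_ext (Strict.comp_id _)
  assoc f g h := hom_ext (Strict.assoc _ _ _)
  leftUnitor_eqToIso f := by ext; simp; rfl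
  rightUnitor_eqToIso f := by ext; simp; rfl
  associator_eqToIso f g h := by ext; simp; rfl

end Algebra
end TwoMonad

/-- A (strict) 2-adjunction `F ⊣ G`. -/
structure TwoAdjunction (F : StrictPseudofunctor B A) (G : StrictPseudofunctor A B) where
  unit : TwoNatTrans (StrictPseudofunctor.id B) (F.comp G)
  counit : TwoNatTrans (G.comp F) (StrictPseudofunctor.id A)
  left_triangle (x : B) : F.map (unit.app x) ≫ counit.app (F.obj x) = 𝟙 (F.obj x)
  right_triangle (x : A) : unit.app (G.obj x) ≫ G.map (counit.app x) = 𝟙 (G.obj x)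

namespace TwoAdjunction
variable {F : StrictPseudofunctor B A} {G : StrictPseudofunctor A B} (adj : TwoAdjunction F G)

/-- The component of the unit at `y`. -/
def unitApp (y : B) : y ⟶ G.obj (F.obj y) := adj.unit.app y
/-- The component of the counit at `x`. -/
def counitApp (x : A) : F.obj (G.obj x) ⟶ x := adj.counit.app x

lemma counitApp_naturality {x y : A} (f : x ⟶ y) :
    F.map (G.map f) ≫ adj.counitApp y = adj.counitApp x ≫ f := adj.counit.naturality f

lemma counitApp_naturality₂ {x y : A} {f g : x ⟶ y} (θ : f ⟶ g) :
    F.map₂ (G.map₂ θ) ▷ adj.counitApp y =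
      eqToHom (adj.counitApp_naturality f) ≫ adj.counitApp x ◁ θ ≫ eqToHom (adj.counitApp_naturality g).symm :=
  adj.counit.naturality₂ θ

lemma map_unitApp_counitApp (x : B) : F.map (adj.unitApp x) ≫ adj.counitApp (F.obj x) = 𝟙 _ := adj.left_triangle x
lemma unitApp_map_counitApp (x : A) : adj.unitApp (G.obj x) ≫ G.map (adj.counitApp x) = 𝟙 _ := adj.right_triangle x

lemma map_counitApp_naturality {x y : A} (f : x ⟶ y) :
    G.map (F.map (G.map f)) ≫ G.map (adj.counitApp y) = G.map (adj.counitApp x) ≫ G.map f := by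
  rw [← G.map_comp, adj.counitApp_naturality, G.map_comp]

lemma map_counitApp_naturality₂ {x y : A} {f g : x ⟶ y} (θ : f ⟶ g) :
    G.map₂ (F.map₂ (G.map₂ θ)) ▷ G.map (adj.counitApp y) =
      eqToHom (adj.map_counitApp_naturality f) ≫ G.map (adj.counitApp x) ◁ G.map₂ θ ≫
        eqToHom (adj.map_counitApp_naturality g).symm := by
  have e := congrArg (fun t => G.map₂ t) (adj.counitApp_naturality₂ θ)
  simp only [map₂_whiskerRight_eq, map₂_whiskerLeft_eq, PrelaxFunctor.map₂_comp,
    PrelaxFunctor.map₂_eqToHom] at e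
  rw [← cancel_epi (eqToHom (G.map_comp _ _)),
    ← cancel_mono (eqToHom (G.map_comp _ _).symm)]
  simpa using e

/-- The 2-monad `(GF, GεF, η)` induced by a 2-adjunction. -/
def monad : TwoMonad B where
  T := F.comp G
  unit := adj.unit
  mult :=
    { app := fun x => G.map (adj.counitApp (F.obj x))
      naturality := fun f => adj.map_counitApp_naturality (F.map f)
      naturality₂ := fun θ => adj.map_counitApp_naturality₂ (F.map₂ θ) }
  map_unit_mult x := by
    change G.map (F.map (adj.unitApp x)) ≫ G.map (adj.counitApp (F.obj x)) = 𝟙 (G.obj (F.obj x))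
    rw [← G.map_comp, map_unitApp_counitApp, G.map_id]
  unit_mult x := adj.unitApp_map_counitApp (F.obj x)
  assoc x := adj.map_counitApp_naturality (adj.counitApp (F.obj x))

variable [Strict B] [Strict A]

/-- The Eilenberg-Moore comparison 2-functor, `x ↦ (G x, G ε_x)`. -/
def comparison : StrictPseudofunctor A adj.monad.Algebra :=
  StrictPseudofunctor.mk''
  { obj := fun x =>
      { carrier := G.obj x
        str := G.map (adj.counitApp x)
        unit_str := adj.unitApp_map_counitApp x
        map_str := adj.map_counitApp_naturality (adj.counitApp x) }
    map := fun f => ⟨G.map f, adj.map_counitApp_naturality f⟩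
    map₂ := fun θ => ⟨G.map₂ θ, adj.map_counitApp_naturality₂ θ⟩
    map₂_id := fun f => by ext; exact G.map₂_id f
    map₂_comp := fun θ φ => by ext; exact G.map₂_comp θ φ
    map_id := fun x => by ext; exact G.map_id x
    map_comp := fun f g => by ext; exact G.map_comp f g
    map₂_whisker_left := fun f _ _ θ => by
      ext; simpa using map₂_whiskerLeft_eq G f θ
    map₂_whisker_right := fun θ g => by
      ext; simpa using map₂_whiskerRight_eq G θ g }

/-- `G` is 2-monadic: the comparison 2-functor is a 2-equivalence. -/
def IsTwoMonadic : Prop := IsTwoEquivalence adj.comparison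

/-- `G` is 2-premonadic: the comparison 2-functor is fully faithful. -/
def IsTwoPremonadic : Prop := IsFullyFaithful adj.comparison

/-- The 2-adjunction is idempotent: it induces an idempotent 2-monad. -/
def IsIdempotent : Prop := adj.monad.IsIdempotent

/-- The 2-adjunction is lax idempotent: it induces a lax idempotent 2-monad. -/
def IsLaxIdempotent : Prop := adj.monad.IsLaxIdempotent

/-- Idempotent and 2-monadic. -/
def IsFullReflective : Prop := adj.IsIdempotent ∧ adj.IsTwoMonadic

/-- Lax idempotent and 2-premonadic. -/
def IsPreKockZoberlein : Prop := adj.IsLaxIdempotent ∧ adj.IsTwoPremonadic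

end TwoAdjunction

variable [Strict B] [Strict A]

/-- A full reflective 2-functor: a right 2-adjoint whose 2-adjunction is idempotent and
2-monadic. -/
def IsFullReflective (G : StrictPseudofunctor A B) : Prop :=
  ∃ (F : StrictPseudofunctor B A) (adj : TwoAdjunction F G), adj.IsFullReflective

/-- A pre-Kock-Zöberlein 2-functor: a right 2-adjoint whose 2-adjunction is lax idempotent and
2-premonadic. -/
def IsPreKockZoberlein (G : StrictPseudofunctor A B) : Prop :=
  ∃ (F : StrictPseudofunctor B A) (adj : TwoAdjunction F G), adj.IsPreKockZoberlein

end Adjunctions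

section Limits
variable {A : Type u} [Bicategory.{w, v} A] [Strict A]

/-- A (two-dimensional) pullback of `b` along `a`. -/
structure PullbackObject {x w y : A} (a : x ⟶ y) (b : w ⟶ y) where
  pt : A
  fst : pt ⟶ x
  snd : pt ⟶ w
  condition : fst ≫ a = snd ≫ b
  existsUnique_lift {z : A} (h₀ : z ⟶ x) (h₁ : z ⟶ w) (e : h₀ ≫ a = h₁ ≫ b) :
    ∃! h : z ⟶ pt, h ≫ fst = h₀ ∧ h ≫ snd = h₁
  existsUnique_lift₂ {z : A} {h h' : z ⟶ pt} (ξ₀ : h ≫ fst ⟶ h' ≫ fst)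
    (ξ₁ : h ≫ snd ⟶ h' ≫ snd)
    (e : ξ₀ ▷ a = eqToHom (by rw [Strict.assoc, condition, ← Strict.assoc]) ≫ ξ₁ ▷ b ≫
      eqToHom (by rw [Strict.assoc, ← condition, ← Strict.assoc])) :
    ∃! ξ : h ⟶ h', ξ ▷ fst = ξ₀ ∧ ξ ▷ snd = ξ₁

/-- A comma object `a ↓ b`, with projections `fst`, `snd` and 2-cell `a · fst ⟹ b · snd`. -/
structure CommaObject {x w y : A} (a : x ⟶ y) (b : w ⟶ y) where
  pt : A
  fst : pt ⟶ x
  snd : pt ⟶ w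
  cell : fst ≫ a ⟶ snd ≫ b
  existsUnique_lift {z : A} (h₀ : z ⟶ x) (h₁ : z ⟶ w) (β : h₀ ≫ a ⟶ h₁ ≫ b) :
    ∃! h : z ⟶ pt, ∃ (e₀ : h ≫ fst = h₀) (e₁ : h ≫ snd = h₁),
      h ◁ cell = eqToHom (by rw [← e₀, Strict.assoc]) ≫ β ≫
        eqToHom (by rw [← e₁, Strict.assoc])
  existsUnique_lift₂ {z : A} {h h' : z ⟶ pt} (ξ₀ : h ≫ fst ⟶ h' ≫ fst)
    (ξ₁ : h ≫ snd ⟶ h' ≫ snd)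
    (e : ξ₀ ▷ a ≫ eqToHom (Strict.assoc _ _ _) ≫ h' ◁ cell =
      eqToHom (Strict.assoc _ _ _) ≫ h ◁ cell ≫ eqToHom (Strict.assoc _ _ _).symm ≫ ξ₁ ▷ b ≫
        eqToHom (Strict.assoc _ _ _)) :
    ∃! ξ : h ⟶ h', ξ ▷ fst = ξ₀ ∧ ξ ▷ snd = ξ₁

variable (A) in
/-- The 2-category `A` has all comma objects. -/
def HasCommaObjects : Prop :=
  ∀ ⦃x w y : A⦄ (a : x ⟶ y) (b : w ⟶ y), Nonempty (CommaObject a b)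

/-- A choice of a pullback of every morphism along `c`. -/
def PullbacksAlong {y z : A} (c : y ⟶ z) := ∀ ⦃x : A⦄ (a : x ⟶ z), PullbackObject a c

/-- A choice of a comma object `a ↓ c` for every morphism `a` with the codomain of `c`. -/
def CommaObjectsAlong {y z : A} (c : y ⟶ z) := ∀ ⦃x : A⦄ (a : x ⟶ z), CommaObject a c

namespace PullbackObject
variable {x w y : A} {a : x ⟶ y} {b : w ⟶ y} (P : PullbackObject a b)

noncomputable def lift {z : A} (h₀ : z ⟶ x) (h₁ : z ⟶ w) (e : h₀ ≫ a = h₁ ≫ b) : z ⟶ P.pt :=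
  (P.existsUnique_lift h₀ h₁ e).choose

lemma lift_fst {z : A} (h₀ : z ⟶ x) (h₁ : z ⟶ w) (e : h₀ ≫ a = h₁ ≫ b) :
    P.lift h₀ h₁ e ≫ P.fst = h₀ := (P.existsUnique_lift h₀ h₁ e).choose_spec.1.1

lemma lift_snd {z : A} (h₀ : z ⟶ x) (h₁ : z ⟶ w) (e : h₀ ≫ a = h₁ ≫ b) :
    P.lift h₀ h₁ e ≫ P.snd = h₁ := (P.existsUnique_lift h₀ h₁ e).choose_spec.1.2

lemma hom_ext {z : A} {h h' : z ⟶ P.pt} (e₀ : h ≫ P.fst = h' ≫ P.fst)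
    (e₁ : h ≫ P.snd = h' ≫ P.snd) : h = h' :=
  (P.existsUnique_lift (h' ≫ P.fst) (h' ≫ P.snd)
    (by rw [Strict.assoc, P.condition, ← Strict.assoc])).unique ⟨e₀, e₁⟩ ⟨rfl, rfl⟩

noncomputable def lift₂ {z : A} {h h' : z ⟶ P.pt} (ξ₀ : h ≫ P.fst ⟶ h' ≫ P.fst)
    (ξ₁ : h ≫ P.snd ⟶ h' ≫ P.snd)
    (e : ξ₀ ▷ a = eqToHom (by rw [Strict.assoc, P.condition, ← Strict.assoc]) ≫ ξ₁ ▷ b ≫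
      eqToHom (by rw [Strict.assoc, ← P.condition, ← Strict.assoc])) : h ⟶ h' :=
  (P.existsUnique_lift₂ ξ₀ ξ₁ e).choose

lemma lift₂_fst {z : A} {h h' : z ⟶ P.pt} (ξ₀ : h ≫ P.fst ⟶ h' ≫ P.fst)
    (ξ₁ : h ≫ P.snd ⟶ h' ≫ P.snd) (e) : P.lift₂ ξ₀ ξ₁ e ▷ P.fst = ξ₀ :=
  (P.existsUnique_lift₂ ξ₀ ξ₁ e).choose_spec.1.1

lemma lift₂_snd {z : A} {h h' : z ⟶ P.pt} (ξ₀ : h ≫ P.fst ⟶ h' ≫ P.fst)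
    (ξ₁ : h ≫ P.snd ⟶ h' ≫ P.snd) (e) : P.lift₂ ξ₀ ξ₁ e ▷ P.snd = ξ₁ :=
  (P.existsUnique_lift₂ ξ₀ ξ₁ e).choose_spec.1.2

lemma hom₂_ext {z : A} {h h' : z ⟶ P.pt} {ξ ξ' : h ⟶ h'} (e₀ : ξ ▷ P.fst = ξ' ▷ P.fst)
    (e₁ : ξ ▷ P.snd = ξ' ▷ P.snd) : ξ = ξ' :=
  (P.existsUnique_lift₂ (ξ' ▷ P.fst) (ξ' ▷ P.snd) (by
    have := whiskerRight_congr ξ' P.condition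
    simp only [Bicategory.whiskerRight_comp, Strict.associator_eqToIso, eqToIso.inv,
      eqToIso.hom, eqToHom_comp_iff, comp_eqToHom_iff, Category.assoc] at this
    simp [this])).unique ⟨e₀, e₁⟩ ⟨rfl, rfl⟩

end PullbackObject

namespace CommaObject
variable {x w y : A} {a : x ⟶ y} {b : w ⟶ y} (P : CommaObject a b)

noncomputable def lift {z : A} (h₀ : z ⟶ x) (h₁ : z ⟶ w) (β : h₀ ≫ a ⟶ h₁ ≫ b) : z ⟶ P.pt :=
  (P.existsUnique_lift h₀ h₁ β).choose

lemma lift_fst {z : A} (h₀ : z ⟶ x) (h₁ : z ⟶ w) (β : h₀ ≫ a ⟶ h₁ ≫ b) :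
    P.lift h₀ h₁ β ≫ P.fst = h₀ := (P.existsUnique_lift h₀ h₁ β).choose_spec.1.choose

lemma lift_snd {z : A} (h₀ : z ⟶ x) (h₁ : z ⟶ w) (β : h₀ ≫ a ⟶ h₁ ≫ b) :
    P.lift h₀ h₁ β ≫ P.snd = h₁ :=
  (P.existsUnique_lift h₀ h₁ β).choose_spec.1.choose_spec.choose

lemma lift_cell {z : A} (h₀ : z ⟶ x) (h₁ : z ⟶ w) (β : h₀ ≫ a ⟶ h₁ ≫ b) :
    P.lift h₀ h₁ β ◁ P.cell = eqToHom (by rw [← Strict.assoc, lift_fst]) ≫ β ≫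
      eqToHom (by rw [← Strict.assoc, lift_snd]) :=
  (P.existsUnique_lift h₀ h₁ β).choose_spec.1.choose_spec.choose_spec

lemma hom_ext {z : A} {h h' : z ⟶ P.pt} (e₀ : h ≫ P.fst = h' ≫ P.fst)
    (e₁ : h ≫ P.snd = h' ≫ P.snd)
    (e : h ◁ P.cell = eqToHom (by rw [← Strict.assoc, e₀, Strict.assoc]) ≫ h' ◁ P.cell ≫
      eqToHom (by rw [← Strict.assoc, ← e₁, Strict.assoc])) : h = h' :=
  (P.existsUnique_lift (h' ≫ P.fst) (h' ≫ P.snd)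
    (eqToHom (Strict.assoc _ _ _) ≫ h' ◁ P.cell ≫ eqToHom (Strict.assoc _ _ _).symm)).unique
    ⟨e₀, e₁, by simp [e]⟩ ⟨rfl, rfl, by simp⟩

noncomputable def lift₂ {z : A} {h h' : z ⟶ P.pt} (ξ₀ : h ≫ P.fst ⟶ h' ≫ P.fst)
    (ξ₁ : h ≫ P.snd ⟶ h' ≫ P.snd)
    (e : ξ₀ ▷ a ≫ eqToHom (Strict.assoc _ _ _) ≫ h' ◁ P.cell =
      eqToHom (Strict.assoc _ _ _) ≫ h ◁ P.cell ≫ eqToHom (Strict.assoc _ _ _).symm ≫ ξ₁ ▷ b ≫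
        eqToHom (Strict.assoc _ _ _)) : h ⟶ h' :=
  (P.existsUnique_lift₂ ξ₀ ξ₁ e).choose

lemma lift₂_fst {z : A} {h h' : z ⟶ P.pt} (ξ₀ : h ≫ P.fst ⟶ h' ≫ P.fst)
    (ξ₁ : h ≫ P.snd ⟶ h' ≫ P.snd) (e) : P.lift₂ ξ₀ ξ₁ e ▷ P.fst = ξ₀ :=
  (P.existsUnique_lift₂ ξ₀ ξ₁ e).choose_spec.1.1

lemma lift₂_snd {z : A} {h h' : z ⟶ P.pt} (ξ₀ : h ≫ P.fst ⟶ h' ≫ P.fst)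
    (ξ₁ : h ≫ P.snd ⟶ h' ≫ P.snd) (e) : P.lift₂ ξ₀ ξ₁ e ▷ P.snd = ξ₁ :=
  (P.existsUnique_lift₂ ξ₀ ξ₁ e).choose_spec.1.2

lemma hom₂_ext {z : A} {h h' : z ⟶ P.pt} {ξ ξ' : h ⟶ h'} (e₀ : ξ ▷ P.fst = ξ' ▷ P.fst)
    (e₁ : ξ ▷ P.snd = ξ' ▷ P.snd) : ξ = ξ' :=
  (P.existsUnique_lift₂ (ξ' ▷ P.fst) (ξ' ▷ P.snd) (by
    have := whisker_exchange ξ' P.cell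
    simp only [Bicategory.whiskerRight_comp, Strict.associator_eqToIso, eqToIso.inv,
      eqToIso.hom, Category.assoc] at this
    simp [this])).unique ⟨e₀, e₁⟩ ⟨rfl, rfl⟩

end CommaObject

end Limits

section BaseChange
variable {A : Type u} [Bicategory.{w, v} A] [Strict A] {y z : A} {c : y ⟶ z}


noncomputable def pullbackBaseChangeMap (P : PullbacksAlong c) {X Y : StrictComma z}
    (f : X ⟶ Y) : (P X.hom).pt ⟶ (P Y.hom).pt :=
  (P Y.hom).lift ((P X.hom).fst ≫ f.map) (P X.hom).snd
    (by rw [Strict.assoc, f.w, (P X.hom).condition])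

lemma pullbackBaseChangeMap_fst (P : PullbacksAlong c) {X Y : StrictComma z} (f : X ⟶ Y) :
    pullbackBaseChangeMap P f ≫ (P Y.hom).fst = (P X.hom).fst ≫ f.map :=
  (P Y.hom).lift_fst _ _ _

lemma pullbackBaseChangeMap_snd (P : PullbacksAlong c) {X Y : StrictComma z} (f : X ⟶ Y) :
    pullbackBaseChangeMap P f ≫ (P Y.hom).snd = (P X.hom).snd :=
  (P Y.hom).lift_snd _ _ _

noncomputable def pullbackBaseChangeMap₂ (P : PullbacksAlong c) {X Y : StrictComma z}
    {f g : X ⟶ Y} (θ : f ⟶ g) : pullbackBaseChangeMap P f ⟶ pullbackBaseChangeMap P g :=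
  (P Y.hom).lift₂
    (eqToHom (pullbackBaseChangeMap_fst P f) ≫ (P X.hom).fst ◁ θ.cell ≫
      eqToHom (pullbackBaseChangeMap_fst P g).symm)
    (eqToHom ((pullbackBaseChangeMap_snd P f).trans (pullbackBaseChangeMap_snd P g).symm))
    (by simp [StrictComma.whiskerRight_w, Strict.associator_eqToIso])

lemma pullbackBaseChangeMap₂_fst (P : PullbacksAlong c) {X Y : StrictComma z}
    {f g : X ⟶ Y} (θ : f ⟶ g) : pullbackBaseChangeMap₂ P θ ▷ (P Y.hom).fst =
      eqToHom (pullbackBaseChangeMap_fst P f) ≫ (P X.hom).fst ◁ θ.cell ≫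
      eqToHom (pullbackBaseChangeMap_fst P g).symm :=
  (P Y.hom).lift₂_fst _ _ _

lemma pullbackBaseChangeMap₂_snd (P : PullbacksAlong c) {X Y : StrictComma z}
    {f g : X ⟶ Y} (θ : f ⟶ g) : pullbackBaseChangeMap₂ P θ ▷ (P Y.hom).snd =
      eqToHom ((pullbackBaseChangeMap_snd P f).trans (pullbackBaseChangeMap_snd P g).symm) :=
  (P Y.hom).lift₂_snd _ _ _

lemma pullbackBaseChangeMap_id (P : PullbacksAlong c) (X : StrictComma z) :
    pullbackBaseChangeMap P (𝟙 X) = 𝟙 _ :=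
  (P X.hom).hom_ext
    (by rw [pullbackBaseChangeMap_fst, StrictComma.id_map, Strict.comp_id, Strict.id_comp])
    (by rw [pullbackBaseChangeMap_snd, Strict.id_comp])

lemma pullbackBaseChangeMap_comp (P : PullbacksAlong c) {X Y Z : StrictComma z} (f : X ⟶ Y)
    (g : Y ⟶ Z) : pullbackBaseChangeMap P (f ≫ g) =
      pullbackBaseChangeMap P f ≫ pullbackBaseChangeMap P g :=
  (P Z.hom).hom_ext
    (by rw [pullbackBaseChangeMap_fst, StrictComma.comp_map, Strict.assoc,
      pullbackBaseChangeMap_fst, ← Strict.assoc, ← Strict.assoc, pullbackBaseChangeMap_fst])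
    (by rw [pullbackBaseChangeMap_snd, Strict.assoc, pullbackBaseChangeMap_snd,
      pullbackBaseChangeMap_snd])

/-- The change of base 2-functor `c^* : A / z ⟶ A / y` given by the pullback along `c`. -/
noncomputable def pullbackBaseChange (P : PullbacksAlong c) :
    StrictPseudofunctor (StrictComma z) (StrictComma y) :=
  StrictPseudofunctor.mk''
  { obj := fun X => ⟨(P X.hom).pt, (P X.hom).snd⟩
    map := fun f => ⟨pullbackBaseChangeMap P f, pullbackBaseChangeMap_snd P f⟩
    map₂ := fun θ =>
      StrictComma.homMk₂ (pullbackBaseChangeMap₂ P θ) (pullbackBaseChangeMap₂_snd P θ)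
    map₂_id := fun {_ Y} f => by
      ext
      apply (P Y.hom).hom₂_ext
      · simp [pullbackBaseChangeMap₂_fst]
      · simp [pullbackBaseChangeMap₂_snd]
    map₂_comp := fun {_ Y _ _ _} θ φ => by
      ext
      apply (P Y.hom).hom₂_ext
      · simp [pullbackBaseChangeMap₂_fst]
      · simp [pullbackBaseChangeMap₂_snd]
    map_id := fun X => by ext; exact pullbackBaseChangeMap_id P X
    map_comp := fun f g => by ext; exact pullbackBaseChangeMap_comp P f g
    map₂_whisker_left := fun {X Y Z} f {g g'} θ => by
      ext
      apply (P Z.hom).hom₂_ext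
      · have e := whiskerLeft_congr (pullbackBaseChangeMap_fst P f) θ.cell
        simp only [Bicategory.comp_whiskerLeft, Strict.associator_eqToIso, eqToIso.inv,
          eqToIso.hom, eqToHom_comp_iff, comp_eqToHom_iff, Category.assoc] at e
        simp [pullbackBaseChangeMap₂_fst, Strict.associator_eqToIso, e]
      · simp [pullbackBaseChangeMap₂_snd, Strict.associator_eqToIso]
    map₂_whisker_right := fun {X Y Z f f'} θ g => by
      ext
      apply (P Z.hom).hom₂_ext
      · have e := whiskerRight_congr (pullbackBaseChangeMap₂ P θ) (pullbackBaseChangeMap_fst P g)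
        simp only [Bicategory.whiskerRight_comp, Strict.associator_eqToIso, eqToIso.inv,
          eqToIso.hom, eqToHom_comp_iff, comp_eqToHom_iff, Category.assoc,
          pullbackBaseChangeMap₂_fst, Bicategory.comp_whiskerRight] at e
        simp [pullbackBaseChangeMap₂_fst, Strict.associator_eqToIso, e]
      · have e := whiskerRight_congr (pullbackBaseChangeMap₂ P θ) (pullbackBaseChangeMap_snd P g)
        simp only [Bicategory.whiskerRight_comp, Strict.associator_eqToIso, eqToIso.inv,
          eqToIso.hom, eqToHom_comp_iff, comp_eqToHom_iff, Category.assoc,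
          pullbackBaseChangeMap₂_snd] at e
        simp [pullbackBaseChangeMap₂_snd, e] }

noncomputable def commaBaseChangeMap (K : CommaObjectsAlong c) {X Y : LaxComma z}
    (f : X ⟶ Y) : (K X.hom).pt ⟶ (K Y.hom).pt :=
  (K Y.hom).lift ((K X.hom).fst ≫ f.map) (K X.hom).snd
    (eqToHom (Strict.assoc _ _ _) ≫ (K X.hom).fst ◁ f.cell ≫ (K X.hom).cell)

lemma commaBaseChangeMap_fst (K : CommaObjectsAlong c) {X Y : LaxComma z} (f : X ⟶ Y) :
    commaBaseChangeMap K f ≫ (K Y.hom).fst = (K X.hom).fst ≫ f.map :=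
  (K Y.hom).lift_fst _ _ _

lemma commaBaseChangeMap_snd (K : CommaObjectsAlong c) {X Y : LaxComma z} (f : X ⟶ Y) :
    commaBaseChangeMap K f ≫ (K Y.hom).snd = (K X.hom).snd :=
  (K Y.hom).lift_snd _ _ _

lemma commaBaseChangeMap_cell (K : CommaObjectsAlong c) {X Y : LaxComma z} (f : X ⟶ Y) :
    commaBaseChangeMap K f ◁ (K Y.hom).cell =
      eqToHom (by rw [← Strict.assoc, commaBaseChangeMap_fst, Strict.assoc]) ≫
        (K X.hom).fst ◁ f.cell ≫ (K X.hom).cell ≫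
          eqToHom (by rw [← Strict.assoc, commaBaseChangeMap_snd]) := by
  have e := (K Y.hom).lift_cell ((K X.hom).fst ≫ f.map) (K X.hom).snd
    (eqToHom (Strict.assoc _ _ _) ≫ (K X.hom).fst ◁ f.cell ≫ (K X.hom).cell)
  simp only [Category.assoc, eqToHom_trans_assoc] at e
  exact e

noncomputable def commaBaseChangeMap₂ (K : CommaObjectsAlong c) {X Y : LaxComma z}
    {f g : X ⟶ Y} (θ : f ⟶ g) : commaBaseChangeMap K f ⟶ commaBaseChangeMap K g :=
  (K Y.hom).lift₂
    (eqToHom (commaBaseChangeMap_fst K f) ≫ (K X.hom).fst ◁ θ.cell ≫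
      eqToHom (commaBaseChangeMap_fst K g).symm)
    (eqToHom ((commaBaseChangeMap_snd K f).trans (commaBaseChangeMap_snd K g).symm))
    (by simp [commaBaseChangeMap_cell, Strict.associator_eqToIso, ← θ.w])

lemma commaBaseChangeMap₂_fst (K : CommaObjectsAlong c) {X Y : LaxComma z}
    {f g : X ⟶ Y} (θ : f ⟶ g) : commaBaseChangeMap₂ K θ ▷ (K Y.hom).fst =
      eqToHom (commaBaseChangeMap_fst K f) ≫ (K X.hom).fst ◁ θ.cell ≫
      eqToHom (commaBaseChangeMap_fst K g).symm :=
  (K Y.hom).lift₂_fst _ _ _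

lemma commaBaseChangeMap₂_snd (K : CommaObjectsAlong c) {X Y : LaxComma z}
    {f g : X ⟶ Y} (θ : f ⟶ g) : commaBaseChangeMap₂ K θ ▷ (K Y.hom).snd =
      eqToHom ((commaBaseChangeMap_snd K f).trans (commaBaseChangeMap_snd K g).symm) :=
  (K Y.hom).lift₂_snd _ _ _

lemma commaBaseChangeMap_id (K : CommaObjectsAlong c) (X : LaxComma z) :
    commaBaseChangeMap K (𝟙 X) = 𝟙 _ :=
  (K X.hom).hom_ext
    (by rw [commaBaseChangeMap_fst, LaxComma.id_map, Strict.comp_id, Strict.id_comp])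
    (by rw [commaBaseChangeMap_snd, Strict.id_comp])
    (by simp [commaBaseChangeMap_cell, Strict.leftUnitor_eqToIso])

lemma commaBaseChangeMap_comp (K : CommaObjectsAlong c) {X Y Z : LaxComma z} (f : X ⟶ Y)
    (g : Y ⟶ Z) : commaBaseChangeMap K (f ≫ g) =
      commaBaseChangeMap K f ≫ commaBaseChangeMap K g :=
  (K Z.hom).hom_ext
    (by rw [commaBaseChangeMap_fst, LaxComma.comp_map, Strict.assoc,
      commaBaseChangeMap_fst, ← Strict.assoc, ← Strict.assoc, commaBaseChangeMap_fst])
    (by rw [commaBaseChangeMap_snd, Strict.assoc, commaBaseChangeMap_snd,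
      commaBaseChangeMap_snd])
    (by
      have e := whiskerLeft_congr (commaBaseChangeMap_fst K f) g.cell
      simp only [Bicategory.comp_whiskerLeft, Strict.associator_eqToIso, eqToIso.inv,
        eqToIso.hom, eqToHom_comp_iff, comp_eqToHom_iff, Category.assoc] at e
      simp [commaBaseChangeMap_cell, Strict.associator_eqToIso, e])

/-- The 2-functor `c^⇐ : A // z ⟶ A / y` given by the comma object along `c`. -/
noncomputable def commaBaseChange (K : CommaObjectsAlong c) :
    StrictPseudofunctor (LaxComma z) (StrictComma y) :=
  StrictPseudofunctor.mk''
  { obj := fun X => ⟨(K X.hom).pt, (K X.hom).snd⟩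
    map := fun f => ⟨commaBaseChangeMap K f, commaBaseChangeMap_snd K f⟩
    map₂ := fun θ =>
      StrictComma.homMk₂ (commaBaseChangeMap₂ K θ) (commaBaseChangeMap₂_snd K θ)
    map₂_id := fun {_ Y} f => by
      ext
      apply (K Y.hom).hom₂_ext
      · simp [commaBaseChangeMap₂_fst]
      · simp [commaBaseChangeMap₂_snd]
    map₂_comp := fun {_ Y _ _ _} θ φ => by
      ext
      apply (K Y.hom).hom₂_ext
      · simp [commaBaseChangeMap₂_fst]
      · simp [commaBaseChangeMap₂_snd]
    map_id := fun X => by ext; exact commaBaseChangeMap_id K X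
    map_comp := fun f g => by ext; exact commaBaseChangeMap_comp K f g
    map₂_whisker_left := fun {X Y Z} f {g g'} θ => by
      ext
      apply (K Z.hom).hom₂_ext
      · have e := whiskerLeft_congr (commaBaseChangeMap_fst K f) θ.cell
        simp only [Bicategory.comp_whiskerLeft, Strict.associator_eqToIso, eqToIso.inv,
          eqToIso.hom, eqToHom_comp_iff, comp_eqToHom_iff, Category.assoc] at e
        simp [commaBaseChangeMap₂_fst, Strict.associator_eqToIso, e]
      · simp [commaBaseChangeMap₂_snd, Strict.associator_eqToIso]
    map₂_whisker_right := fun {X Y Z f f'} θ g => by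
      ext
      apply (K Z.hom).hom₂_ext
      · have e := whiskerRight_congr (commaBaseChangeMap₂ K θ) (commaBaseChangeMap_fst K g)
        simp only [Bicategory.whiskerRight_comp, Strict.associator_eqToIso, eqToIso.inv,
          eqToIso.hom, eqToHom_comp_iff, comp_eqToHom_iff, Category.assoc,
          commaBaseChangeMap₂_fst, Bicategory.comp_whiskerRight] at e
        simp [commaBaseChangeMap₂_fst, Strict.associator_eqToIso, e]
      · have e := whiskerRight_congr (commaBaseChangeMap₂ K θ) (commaBaseChangeMap_snd K g)
        simp only [Bicategory.whiskerRight_comp, Strict.associator_eqToIso, eqToIso.inv,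
          eqToIso.hom, eqToHom_comp_iff, comp_eqToHom_iff, Category.assoc,
          commaBaseChangeMap₂_snd] at e
        simp [commaBaseChangeMap₂_snd, e] }

end BaseChange

section Lift
variable {A : Type u} [Bicategory.{w, v} A] [Strict A] {B : Type u₁} [Bicategory.{w₁, v₁} B]
  [Strict B]

/-- The 2-functor `Ǧ : A / x ⟶ B / G x` defined pointwise by `G`. -/
def strictCommaLift (G : StrictPseudofunctor A B) (x : A) :
    StrictPseudofunctor (StrictComma x) (StrictComma (G.obj x)) :=
  StrictPseudofunctor.mk''
  { obj := fun X => ⟨G.obj X.left, G.map X.hom⟩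
    map := fun f => ⟨G.map f.map, by rw [← G.map_comp, f.w]⟩
    map₂ := fun θ => StrictComma.homMk₂ (G.map₂ θ.cell) (by
      have e := congrArg (fun t => G.map₂ t) (StrictComma.whiskerRight_w θ)
      simp only [map₂_whiskerRight_eq, PrelaxFunctor.map₂_eqToHom, eqToHom_comp_iff,
        comp_eqToHom_iff] at e
      simp [e])
    map₂_id := fun f => by ext; exact G.map₂_id f.map
    map₂_comp := fun θ φ => by ext; exact G.map₂_comp θ.cell φ.cell
    map_id := fun X => by ext; exact G.map_id X.left
    map_comp := fun f g => by ext; exact G.map_comp f.map g.map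
    map₂_whisker_left := fun f _ _ θ => by
      ext; simpa using map₂_whiskerLeft_eq G f.map θ.cell
    map₂_whisker_right := fun θ g => by
      ext; simpa using map₂_whiskerRight_eq G θ.cell g.map }

/-- The 2-functor `Ǧ : A // x ⟶ B // G x` defined pointwise by `G`. -/
def laxCommaLift (G : StrictPseudofunctor A B) (x : A) :
    StrictPseudofunctor (LaxComma x) (LaxComma (G.obj x)) :=
  StrictPseudofunctor.mk''
  { obj := fun X => ⟨G.obj X.left, G.map X.hom⟩
    map := fun {_ Y} f => ⟨G.map f.map, eqToHom (G.map_comp f.map Y.hom).symm ≫ G.map₂ f.cell⟩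
    map₂ := fun θ => LaxComma.Hom₂.mk (G.map₂ θ.cell) (by
      have e := congrArg (fun t => G.map₂ t) θ.w
      simp only [map₂_whiskerRight_eq, PrelaxFunctor.map₂_comp] at e
      simp [← e])
    map₂_id := fun f => by ext; exact G.map₂_id f.map
    map₂_comp := fun θ φ => by ext; exact G.map₂_comp θ.cell φ.cell
    map_id := fun X => LaxComma.hom_ext (G.map_id X.left) (by
      simp [Strict.leftUnitor_eqToIso, PrelaxFunctor.map₂_eqToHom])
    map_comp := fun f g => LaxComma.hom_ext (G.map_comp f.map g.map) (by
      simp [Strict.associator_eqToIso, G.mapComp_eq_eqToIso, PrelaxFunctor.map₂_eqToHom])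
    map₂_whisker_left := fun f _ _ θ => by
      ext; simpa using map₂_whiskerLeft_eq G f.map θ.cell
    map₂_whisker_right := fun θ g => by
      ext; simpa using map₂_whiskerRight_eq G θ.cell g.map }

end Lift

section Admissibility
variable {A : Type u} [Bicategory.{w, v} A] [Strict A] {B : Type u₁} [Bicategory.{w₁, v₁} B]
  [Strict B] {F : StrictPseudofunctor B A} {G : StrictPseudofunctor A B}

/-- `F ⊣ G` is admissible with respect to the basic fibration: `G` is fully faithful, and
`η_y^* ∘ Ǧ : A / F y ⟶ B / y` is full reflective for every `y`. -/
def TwoAdjunction.IsAdmissible (adj : TwoAdjunction F G)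
    (P : ∀ y : B, PullbacksAlong (adj.unitApp y)) : Prop :=
  IsFullyFaithful G ∧
    ∀ y : B, TwoCat.IsFullReflective
      ((strictCommaLift G (F.obj y)).comp (pullbackBaseChange (P y)))

/-- `F ⊣ G` is 2-admissible: it is pre-Kock-Zöberlein, and `η_y^⇐ ∘ Ǧ : A // F y ⟶ B / y` is
pre-Kock-Zöberlein for every `y`. -/
def TwoAdjunction.IsTwoAdmissible (adj : TwoAdjunction F G)
    (K : ∀ y : B, CommaObjectsAlong (adj.unitApp y)) : Prop :=
  adj.IsPreKockZoberlein ∧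
    ∀ y : B, TwoCat.IsPreKockZoberlein
      ((laxCommaLift G (F.obj y)).comp (commaBaseChange (K y)))

end Admissibility
end TwoCat

set_option linter.unusedSectionVars false

/-! That `G` is pre-Kock–Zöberlein is formal: full faithfulness makes `ηG` invertible, so `μ ≫ ηT`
is an identity, the unit of `μ ⊣ ηT` can be an identity, and algebra morphisms are just morphisms in
the image of `G`.

Now fix `y`. For any 2-adjunction with comma objects along `η_y`, the 2-functor `A // F y ⟶ B / y`,
`(w, a) ↦ (G a ↓ η_y)`, has as left 2-adjoint `(x, b) ↦ (F x, F b)`, whose values on morphisms are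
strict (`commaAdjunction`). Its counit at `a` is the transpose of the first projection together with
the transpose of the universal 2-cell.

Admissibility identifies the domain of this counit. Full reflectivity of `η_y^* ∘ Ǧ` says that the
transpose `F Q ⟶ Z` of the first projection of the pullback `Q` of `G Z` along `η_y` is invertible
(`exists_inv_map_fst_counitApp`). Apply this to `Z = (a ↓ 1)`, a comma object in `A` lying over `F
y`. Pulling `G (a ↓ 1)` back along `η_y` gives `G a ↓ η_y`, so `F (G a ↓ η_y) ≅ (a ↓ 1)` over `F y`
(`exists_inv_commaComparison`).

The comma object `a ↓ 1` turns lax morphisms into strict ones: a lax morphism `Z ⟶ (w, a)` is the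
same thing as a strict morphism `Z ⟶ (a ↓ 1)`. On 2-cells, if `f` is lax and `g` is strict, 2-cells
`f ⟹ g` into `a ↓ 1` correspond to 2-cells between their composites with the counit. The
correspondence on 2-cells gives lax idempotence (`isLaxIdempotent_of_bijective`). The one on
morphisms exhibits each counit as a split coequalizer, which gives 2-premonadicity
(`isTwoPremonadic_of_split`). -/

namespace TwoCat

/-! ### Calculus of 2-cells up to equality of their boundary 1-cells -/

section Cells
variable {A : Type u} [Bicategory.{w, v} A]

/-- A 2-cell bundled with its source and target. Equality of bundled 2-cells is equality up to
`eqToHom`. -/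
structure Cell (a b : A) where
  src : a ⟶ b
  tgt : a ⟶ b
  hom : src ⟶ tgt

namespace Cell

@[simps]
def of {a b : A} {f g : a ⟶ b} (θ : f ⟶ g) : Cell a b := ⟨f, g, θ⟩

/-- The identity 2-cell, bundled. -/
def id {a b : A} (f : a ⟶ b) : Cell a b := of (𝟙 f)

/-- Left whiskering of a bundled 2-cell. -/
def wl {a b c : A} (f : a ⟶ b) (x : Cell b c) : Cell a c := of (f ◁ x.hom)

/-- Right whiskering of a bundled 2-cell. -/
def wr {a b c : A} (x : Cell a b) (g : b ⟶ c) : Cell a c := of (x.hom ▷ g)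

/-- Vertical composition of bundled 2-cells. -/
def vc {a b : A} (x y : Cell a b) (h : x.tgt = y.src) : Cell a b :=
  of (x.hom ≫ eqToHom h ≫ y.hom)

@[simp] lemma id_src {a b : A} (f : a ⟶ b) : (id f).src = f := rfl
@[simp] lemma id_tgt {a b : A} (f : a ⟶ b) : (id f).tgt = f := rfl
@[simp] lemma wl_src {a b c : A} (f : a ⟶ b) (x : Cell b c) : (wl f x).src = f ≫ x.src := rfl
@[simp] lemma wl_tgt {a b c : A} (f : a ⟶ b) (x : Cell b c) : (wl f x).tgt = f ≫ x.tgt := rfl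
@[simp] lemma wr_src {a b c : A} (x : Cell a b) (g : b ⟶ c) : (wr x g).src = x.src ≫ g := rfl
@[simp] lemma wr_tgt {a b c : A} (x : Cell a b) (g : b ⟶ c) : (wr x g).tgt = x.tgt ≫ g := rfl

/-- This is how the calculus is used: an equation of 2-cells with a common boundary is checked after
bundling, where every `eqToHom` factor disappears. -/
lemma of_injective {a b : A} {f g : a ⟶ b} {θ θ' : f ⟶ g} (h : of θ = of θ') : θ = θ' := by
  simpa [of] using h

@[simp] lemma of_eqToHom {a b : A} {f g : a ⟶ b} (h : f = g) : of (eqToHom h) = id f := by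
  subst h; rfl

@[simp] lemma of_eqToHom_comp {a b : A} {f g h : a ⟶ b} (e : f = g) (θ : g ⟶ h) :
    of (eqToHom e ≫ θ) = of θ := by
  subst e; rw [eqToHom_refl, Category.id_comp]

@[simp] lemma of_comp_eqToHom {a b : A} {f g h : a ⟶ b} (θ : f ⟶ g) (e : g = h) :
    of (θ ≫ eqToHom e) = of θ := by
  subst e; rw [eqToHom_refl, Category.comp_id]

lemma of_comp {a b : A} {f g h : a ⟶ b} (θ : f ⟶ g) (φ : g ⟶ h) :
    of (θ ≫ φ) = vc (of θ) (of φ) rfl :=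
  congrArg (fun t => of (θ ≫ t)) (Category.id_comp φ).symm

@[simp] lemma of_whiskerLeft {a b c : A} (f : a ⟶ b) {g h : b ⟶ c} (θ : g ⟶ h) :
    of (f ◁ θ) = wl f (of θ) := rfl

@[simp] lemma of_whiskerRight {a b c : A} {f g : a ⟶ b} (θ : f ⟶ g) (h : b ⟶ c) :
    of (θ ▷ h) = wr (of θ) h := rfl

/-- A bundled 2-cell with prescribed boundary. -/
def cast {a b : A} {f g : a ⟶ b} (x : Cell a b) (hs : f = x.src) (ht : g = x.tgt) : f ⟶ g :=
  eqToHom hs ≫ x.hom ≫ eqToHom ht.symm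

@[simp] lemma of_cast {a b : A} {f g : a ⟶ b} (x : Cell a b) (hs : f = x.src) (ht : g = x.tgt) :
    of (x.cast hs ht) = x := by
  rw [cast, of_eqToHom_comp, of_comp_eqToHom]; rfl

@[simp] lemma wl_id {a b c : A} (f : a ⟶ b) (g : b ⟶ c) : wl f (id g) = id (f ≫ g) :=
  congrArg of (Bicategory.whiskerLeft_id f g)

@[simp] lemma id_wr {a b c : A} (f : a ⟶ b) (g : b ⟶ c) : wr (id f) g = id (f ≫ g) :=
  congrArg of (Bicategory.id_whiskerRight f g)

lemma vc_of {a b : A} {f g h : a ⟶ b} (θ : f ⟶ g) (φ : g ⟶ h) (e) :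
    vc (of θ) (of φ) e = of (θ ≫ φ) := (of_comp θ φ).symm

lemma wl_tgt_eq_src {a b c : A} (f : a ⟶ b) {x y : Cell b c} (h : x.tgt = y.src) :
    (wl f x).tgt = (wl f y).src := congrArg (f ≫ ·) h

lemma wr_tgt_eq_src {a b c : A} {x y : Cell a b} (h : x.tgt = y.src) (g : b ⟶ c) :
    (wr x g).tgt = (wr y g).src := congrArg (· ≫ g) h

lemma wl_vc {a b c : A} (f : a ⟶ b) (x y : Cell b c) (h) :
    wl f (vc x y h) = vc (wl f x) (wl f y) (wl_tgt_eq_src f h) := by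
  obtain ⟨_, _, x⟩ := x
  obtain ⟨_, _, y⟩ := y
  dsimp at h
  subst h
  exact (congrArg (wl f) (vc_of x y _)).trans
    ((congrArg of (Bicategory.whiskerLeft_comp f x y)).trans (vc_of _ _ _).symm)

lemma wr_vc {a b c : A} (x y : Cell a b) (h) (g : b ⟶ c) :
    wr (vc x y h) g = vc (wr x g) (wr y g) (wr_tgt_eq_src h g) := by
  obtain ⟨_, _, x⟩ := x
  obtain ⟨_, _, y⟩ := y
  dsimp at h
  subst h
  exact (congrArg (wr · g) (vc_of x y _)).trans
    ((congrArg of (Bicategory.comp_whiskerRight x y g)).trans (vc_of _ _ _).symm)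

@[simp] lemma id_vc {a b : A} (f : a ⟶ b) (x : Cell a b) (h) : vc (id f) x h = x := by
  obtain ⟨_, _, x⟩ := x
  dsimp at h
  subst h
  exact (vc_of _ _ _).trans (congrArg of (Category.id_comp x))

@[simp] lemma vc_id {a b : A} (f : a ⟶ b) (x : Cell a b) (h) : vc x (id f) h = x := by
  obtain ⟨_, _, x⟩ := x
  dsimp at h
  subst h
  exact (vc_of _ _ _).trans (congrArg of (Category.comp_id x))

section Strict
variable [Strict A]

/-- In a strict 2-category the associators and unitors are `eqToHom`, so the coherence laws for
whiskering become plain equations of bundled cells and can be used for rewriting. -/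
lemma wl_wl {a b c d : A} (f : a ⟶ b) (g : b ⟶ c) (x : Cell c d) :
    wl f (wl g x) = wl (f ≫ g) x := by
  change _ = of ((f ≫ g) ◁ x.hom)
  rw [Bicategory.comp_whiskerLeft, Strict.associator_eqToIso, Strict.associator_eqToIso,
    eqToIso.hom, eqToIso.inv, of_eqToHom_comp, of_comp_eqToHom]
  rfl

lemma wr_wr {a b c d : A} (x : Cell a b) (f : b ⟶ c) (g : c ⟶ d) :
    wr (wr x f) g = wr x (f ≫ g) := by
  change _ = of (x.hom ▷ (f ≫ g))
  rw [Bicategory.whiskerRight_comp, Strict.associator_eqToIso, Strict.associator_eqToIso,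
    eqToIso.hom, eqToIso.inv, of_eqToHom_comp, of_comp_eqToHom]
  rfl

lemma wr_wl {a b c d : A} (f : a ⟶ b) (x : Cell b c) (g : c ⟶ d) :
    wr (wl f x) g = wl f (wr x g) := by
  change of ((f ◁ x.hom) ▷ g) = _
  rw [Bicategory.whisker_assoc, Strict.associator_eqToIso, Strict.associator_eqToIso,
    eqToIso.hom, eqToIso.inv, of_eqToHom_comp, of_comp_eqToHom]
  rfl

@[simp] lemma id_wl {a b : A} (x : Cell a b) : wl (𝟙 a) x = x := by
  change of (𝟙 a ◁ x.hom) = _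
  rw [Bicategory.id_whiskerLeft, Strict.leftUnitor_eqToIso, Strict.leftUnitor_eqToIso,
    eqToIso.hom, eqToIso.inv, of_eqToHom_comp, of_comp_eqToHom]
  rfl

@[simp] lemma wr_id {a b : A} (x : Cell a b) : wr x (𝟙 b) = x := by
  change of (x.hom ▷ 𝟙 b) = _
  rw [Bicategory.whiskerRight_id, Strict.rightUnitor_eqToIso, Strict.rightUnitor_eqToIso,
    eqToIso.hom, eqToIso.inv, of_eqToHom_comp, of_comp_eqToHom]
  rfl

end Strict

variable {B : Type u₁} [Bicategory.{w₁, v₁} B]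

def map (F : StrictPseudofunctor A B) {a b : A} (x : Cell a b) : Cell (F.obj a) (F.obj b) :=
  of (F.map₂ x.hom)

@[simp] lemma map_src (F : StrictPseudofunctor A B) {a b : A} (x : Cell a b) :
    (map F x).src = F.map x.src := rfl
@[simp] lemma map_tgt (F : StrictPseudofunctor A B) {a b : A} (x : Cell a b) :
    (map F x).tgt = F.map x.tgt := rfl

@[simp] lemma of_map₂ (F : StrictPseudofunctor A B) {a b : A} {f g : a ⟶ b} (θ : f ⟶ g) :
    of (F.map₂ θ) = map F (of θ) := rfl

@[simp] lemma map_id (F : StrictPseudofunctor A B) {a b : A} (f : a ⟶ b) :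
    map F (id f) = id (F.map f) :=
  congrArg of (F.map₂_id f)

lemma map_wl (F : StrictPseudofunctor A B) {a b c : A} (f : a ⟶ b) (x : Cell b c) :
    map F (wl f x) = wl (F.map f) (map F x) := by
  change of (F.map₂ (f ◁ x.hom)) = _
  rw [map₂_whiskerLeft_eq, of_eqToHom_comp, of_comp_eqToHom]
  rfl

lemma map_wr (F : StrictPseudofunctor A B) {a b c : A} (x : Cell a b) (g : b ⟶ c) :
    map F (wr x g) = wr (map F x) (F.map g) := by
  change of (F.map₂ (x.hom ▷ g)) = _
  rw [map₂_whiskerRight_eq, of_eqToHom_comp, of_comp_eqToHom]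
  rfl

lemma map_tgt_eq_src (F : StrictPseudofunctor A B) {a b : A} {x y : Cell a b}
    (h : x.tgt = y.src) : (map F x).tgt = (map F y).src := congrArg (fun k => F.map k) h

lemma map_vc (F : StrictPseudofunctor A B) {a b : A} (x y : Cell a b) (h) :
    map F (vc x y h) = vc (map F x) (map F y) (map_tgt_eq_src F h) := by
  obtain ⟨_, _, x⟩ := x
  obtain ⟨_, _, y⟩ := y
  dsimp at h
  subst h
  exact (congrArg (map F) (vc_of x y _)).trans
    ((congrArg of (F.map₂_comp x y)).trans (vc_of _ _ _).symm)

end Cell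

lemma TwoNatTrans.cell_naturality {B : Type u₁} [Bicategory.{w₁, v₁} B]
    {F G : StrictPseudofunctor A B} (α : TwoNatTrans F G) {a b : A} (x : Cell a b) :
    (x.map F).wr (α.app b) = (x.map G).wl (α.app a) := by
  change Cell.of (F.map₂ x.hom ▷ α.app b) = _
  rw [α.naturality₂, Cell.of_eqToHom_comp, Cell.of_comp_eqToHom]
  rfl

end Cells

/-! ### Transposition, and criteria for lax idempotence and 2-premonadicity -/

namespace TwoAdjunction
variable {A : Type u} [Bicategory.{w, v} A] [Strict A] {B : Type u₁} [Bicategory.{w₁, v₁} B]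
  [Strict B] {F : StrictPseudofunctor B A} {G : StrictPseudofunctor A B} (adj : TwoAdjunction F G)

lemma unitApp_naturality {x y : B} (f : x ⟶ y) :
    f ≫ adj.unitApp y = adj.unitApp x ≫ G.map (F.map f) := adj.unit.naturality f

lemma unitApp_naturality_assoc {x y z : B} (f : x ⟶ y) (g : G.obj (F.obj y) ⟶ z) :
    f ≫ adj.unitApp y ≫ g = adj.unitApp x ≫ G.map (F.map f) ≫ g := by
  rw [← Strict.assoc, unitApp_naturality, Strict.assoc]

lemma counitApp_naturality_assoc {x y z : A} (f : x ⟶ y) (g : y ⟶ z) :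
    F.map (G.map f) ≫ adj.counitApp y ≫ g = adj.counitApp x ≫ f ≫ g := by
  rw [← Strict.assoc, counitApp_naturality, Strict.assoc]

lemma map_unitApp_counitApp_assoc {x : B} {z : A} (g : F.obj x ⟶ z) :
    F.map (adj.unitApp x) ≫ adj.counitApp (F.obj x) ≫ g = g := by
  rw [← Strict.assoc, map_unitApp_counitApp, Strict.id_comp]

lemma unitApp_map_counitApp_assoc {x : A} {z : B} (g : G.obj x ⟶ z) :
    adj.unitApp (G.obj x) ≫ G.map (adj.counitApp x) ≫ g = g := by
  rw [← Strict.assoc, unitApp_map_counitApp, Strict.id_comp]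

lemma cell_unitApp_naturality {x y : B} (c : Cell x y) :
    c.wr (adj.unitApp y) = ((c.map F).map G).wl (adj.unitApp x) := adj.unit.cell_naturality c

lemma cell_counitApp_naturality {x y : A} (c : Cell x y) :
    ((c.map G).map F).wr (adj.counitApp y) = c.wl (adj.counitApp x) :=
  adj.counit.cell_naturality c

lemma transpose_injective {b : B} {x : A} {f g : b ⟶ G.obj x}
    (h : F.map f ≫ adj.counitApp x = F.map g ≫ adj.counitApp x) : f = g := by
  have h' := congrArg (fun k => adj.unitApp b ≫ G.map k) h
  simpa only [G.map_comp, ← adj.unitApp_naturality_assoc, adj.unitApp_map_counitApp,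
    Strict.comp_id] using h'

lemma hom_ext_of_unitApp {b : B} {x : A} {f g : F.obj b ⟶ x}
    (h : adj.unitApp b ≫ G.map f = adj.unitApp b ≫ G.map g) : f = g := by
  have h' := congrArg (fun k => F.map k ≫ adj.counitApp x) h
  simpa only [F.map_comp, Strict.assoc, adj.counitApp_naturality,
    adj.map_unitApp_counitApp_assoc] using h'

lemma map_unitApp_map_counitApp {b : B} {x : A} (f : F.obj b ⟶ x) :
    F.map (adj.unitApp b ≫ G.map f) ≫ adj.counitApp x = f := by
  rw [F.map_comp, Strict.assoc, counitApp_naturality, map_unitApp_counitApp_assoc]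

/-- Naturality of `η` on 2-cells and the right triangle identity: transposing a 2-cell and
transposing back returns it. -/
lemma cell_unit_transpose {b : B} {x : A} (c : Cell b (G.obj x)) :
    (((c.map F).wr (adj.counitApp x)).map G).wl (adj.unitApp b) = c := by
  rw [Cell.map_wr, ← Cell.wr_wl, ← cell_unitApp_naturality, Cell.wr_wr, unitApp_map_counitApp,
    Cell.wr_id]

/-- The hypothesis gives a unique `θ : ε_{FGFx} ⟹ FGε_{Fx}` that becomes an identity after
whiskering with `ε_{Fx}`. The unit of `μ ⊣ ηT` is its transpose, and the modification law and the
unit-side triangle identity follow from the injectivity of whiskering with the counit. -/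
lemma isLaxIdempotent_of_bijective
    (H : ∀ (x : A) (b : B) (h : F.obj b ⟶ F.obj (G.obj x)) (g : b ⟶ G.obj x),
      Function.Bijective (fun θ : h ⟶ F.map g => θ ▷ adj.counitApp x)) :
    adj.IsLaxIdempotent := by
  -- Injectivity for bundled cells, so that the target need only be equal to some `F g`, rather than
  -- being given in that form.
  have inj : ∀ {x : A} {b : B} {c c' : Cell (F.obj b) (F.obj (G.obj x))} (g : b ⟶ G.obj x),
      c.src = c'.src → c.tgt = F.map g → c'.tgt = F.map g →
      c.wr (adj.counitApp x) = c'.wr (adj.counitApp x) → c = c' := by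
    rintro x b ⟨s, t, c⟩ ⟨s', t', c'⟩ g h₁ h₂ h₃ h
    dsimp at h₁ h₂ h₃
    subst h₁ h₂ h₃
    exact congrArg Cell.of ((H x b _ g).1 (Cell.of_injective h))
  -- Naturality of `ε` at `ε_{Fx}` makes the two composites equal, so the identity 2-cell can be
  -- lifted along the bijection.
  choose θ hθ using fun x : B => (H (F.obj x) (G.obj (F.obj (G.obj (F.obj x))))
    (adj.counitApp _) (G.map (adj.counitApp _))).2
      (eqToHom (adj.counitApp_naturality (adj.counitApp (F.obj x))).symm)
  have hθ' : ∀ x, (Cell.of (θ x)).wr (adj.counitApp (F.obj x)) =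
      Cell.id (adj.counitApp _ ≫ adj.counitApp _) := fun x => by
    rw [← Cell.of_whiskerRight]
    exact (congrArg Cell.of (hθ x)).trans (by simp)
  -- The source is `η ≫ Gε = 𝟙` by a triangle identity, and the target is `η ≫ GFGε = Gε ≫ η` by
  -- naturality.
  let γ : ∀ x : B, Cell (G.obj (F.obj (G.obj (F.obj x)))) (G.obj (F.obj (G.obj (F.obj x)))) :=
    fun x => ((Cell.of (θ x)).map G).wl (adj.unitApp _)
  let Γ : ∀ x : B, 𝟙 (G.obj (F.obj (G.obj (F.obj x)))) ⟶
      G.map (adj.counitApp (F.obj x)) ≫ adj.unitApp (G.obj (F.obj x)) := fun x =>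
    (γ x).cast (adj.unitApp_map_counitApp _).symm (adj.unitApp_naturality _)
  have hΓ : ∀ x, Cell.of (Γ x) = γ x := fun x => Cell.of_cast _ _ _
  refine ⟨Γ, ?_, ?_, ?_⟩
  · intro x y f
    refine Cell.of_injective ?_
    simp only [Cell.of_eqToHom_comp, Cell.of_comp_eqToHom]
    change (Cell.of (Γ x)).wr (G.map (F.map (G.map (F.map f)))) =
      (Cell.of (Γ y)).wl (G.map (F.map (G.map (F.map f))))
    rw [hΓ, hΓ]
    dsimp only [γ]
    rw [Cell.wr_wl, Cell.wl_wl, unitApp_naturality, ← Cell.wl_wl, ← Cell.map_wr, ← Cell.map_wl]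
    congr 2
    -- After whiskering with `ε`, both cells are identities because each `θ` becomes one.
    refine inj (G.map (adj.counitApp (F.obj x)) ≫ G.map (F.map f)) ?_ ?_ ?_ ?_
    · simp [counitApp_naturality]
    · simp [F.map_comp]
    · simp [← F.map_comp, map_counitApp_naturality]
    · rw [Cell.wr_wr, Cell.wr_wl, hθ', counitApp_naturality, ← Cell.wr_wr, hθ', Cell.id_wr,
        Cell.wl_id, Strict.assoc, counitApp_naturality_assoc, counitApp_naturality]
  · intro x
    refine Cell.of_injective ?_
    simp only [Cell.of_eqToHom]
    change (Cell.of (Γ x)).wl (adj.unitApp (G.obj (F.obj x))) = Cell.id (adj.unitApp _ ≫ 𝟙 _)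
    rw [hΓ]
    dsimp only [γ]
    rw [Cell.wl_wl, unitApp_naturality, ← Cell.wl_wl, ← Cell.map_wl]
    -- This cell runs from the identity to the identity and becomes an identity after whiskering
    -- with `ε`, so it is itself an identity.
    have e : (Cell.of (θ x)).wl (F.map (adj.unitApp (G.obj (F.obj x)))) = Cell.id (𝟙 _) := by
      refine inj (𝟙 _) ?_ ?_ ?_ ?_
      · simp [map_unitApp_counitApp]
      · simp [← F.map_comp, unitApp_map_counitApp]
      · simp [F.map_id]
      · rw [Cell.wr_wl, hθ', Cell.wl_id, Cell.id_wr, map_unitApp_counitApp_assoc, Strict.id_comp]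
    rw [e, Cell.map_id, Cell.wl_id, G.map_id]
  · intro x
    refine Cell.of_injective ?_
    simp only [Cell.of_eqToHom]
    change (Cell.of (Γ x)).wr (G.map (adj.counitApp (F.obj x))) = Cell.id (𝟙 _ ≫ G.map _)
    rw [hΓ]
    dsimp only [γ]
    rw [Cell.wr_wl, ← Cell.map_wr, hθ', Cell.map_id, Cell.wl_id, G.map_comp,
      unitApp_map_counitApp_assoc, Strict.id_comp]

/-- If every counit component is a split coequalizer of `ε_{FGx}` and `FGε_x`, the comparison
2-functor is fully faithful. -/
lemma isTwoPremonadic_of_split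
    (H : ∀ x : A, ∃ (s : x ⟶ F.obj (G.obj x))
      (t : F.obj (G.obj x) ⟶ F.obj (G.obj (F.obj (G.obj x)))),
      s ≫ adj.counitApp x = 𝟙 x ∧ t ≫ F.map (G.map (adj.counitApp x)) = 𝟙 _ ∧
      t ≫ adj.counitApp (F.obj (G.obj x)) = adj.counitApp x ≫ s) :
    adj.IsTwoPremonadic := by
  intro x x'
  obtain ⟨s, t, hs, ht, hst⟩ := H x
  have hs' : ∀ {z : A} (g : x ⟶ z), s ≫ adj.counitApp x ≫ g = g := fun g => by
    rw [← Strict.assoc, hs, Strict.id_comp]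
  refine ⟨⟨fun f g h => ?_, fun k => ?_⟩, fun f g => ⟨fun θ φ h => ?_, fun κ => ?_⟩⟩
  · have e : G.map f = G.map g := congrArg TwoMonad.Algebra.Hom.map h
    rw [← hs' f, ← hs' g, ← counitApp_naturality, ← counitApp_naturality, e]
  · obtain ⟨k, hk⟩ := k
    change G.obj x ⟶ G.obj x' at k
    change G.map (F.map k) ≫ G.map (adj.counitApp x') = G.map (adj.counitApp x) ≫ k at hk
    -- Since `k` is an algebra morphism, `F k ≫ ε` coequalizes `ε_{FGx}` and `FGε_x`. The splitting
    -- then factors it through `ε_x` by precomposition with `s`. Only the splitting at the domain is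
    -- used.
    have e : adj.counitApp x ≫ s ≫ F.map k ≫ adj.counitApp x' =
        F.map k ≫ adj.counitApp x' := by
      rw [← Strict.assoc, ← hst, Strict.assoc, ← counitApp_naturality_assoc,
        ← counitApp_naturality, ← Strict.assoc (F.map _), ← F.map_comp, hk, F.map_comp,
        Strict.assoc, ← Strict.assoc t, ht, Strict.id_comp]
    refine ⟨s ≫ F.map k ≫ adj.counitApp x', TwoMonad.Algebra.hom_ext ?_⟩
    refine adj.transpose_injective ?_
    change F.map (G.map (s ≫ F.map k ≫ adj.counitApp x')) ≫ _ = _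
    rw [counitApp_naturality]
    exact e
  · have e : (Cell.of θ).map G = (Cell.of φ).map G :=
      congrArg (fun t => Cell.of (TwoMonad.Algebra.Hom₂.cell t)) h
    refine Cell.of_injective ?_
    rw [← Cell.id_wl (Cell.of θ), ← Cell.id_wl (Cell.of φ), ← hs, ← Cell.wl_wl, ← Cell.wl_wl,
      ← cell_counitApp_naturality, ← cell_counitApp_naturality, e]
  · obtain ⟨κ, hκ⟩ := κ
    change G.map f ⟶ G.map g at κ
    have hc : (((Cell.of κ).map F).map G).wr (G.map (adj.counitApp x')) =
        (Cell.of κ).wl (G.map (adj.counitApp x)) := by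
      refine (congrArg Cell.of hκ).trans ?_
      simp only [Cell.of_eqToHom_comp, Cell.of_comp_eqToHom]
      rfl
    -- The same factorization for 2-cells, since a split coequalizer is preserved by every 2-functor
    -- and so also has the two-dimensional universal property.
    have e : ((((Cell.of κ).map F).wr (adj.counitApp x')).wl s).wl (adj.counitApp x) =
        ((Cell.of κ).map F).wr (adj.counitApp x') := by
      rw [Cell.wl_wl, ← hst, ← Cell.wl_wl, ← cell_counitApp_naturality, Cell.map_wr, hc,
        Cell.map_wl, Cell.wr_wl, Cell.wl_wl, ht, Cell.id_wl]
    let θ : f ⟶ g := ((((Cell.of κ).map F).wr (adj.counitApp x')).wl s).cast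
      (by simp [counitApp_naturality, hs']) (by simp [counitApp_naturality, hs'])
    refine ⟨θ, TwoMonad.Algebra.hom₂_ext (Cell.of_injective ?_)⟩
    change (Cell.of θ).map G = Cell.of κ
    rw [← adj.cell_unit_transpose ((Cell.of θ).map G), cell_counitApp_naturality, Cell.of_cast, e,
      cell_unit_transpose]

end TwoAdjunction
end TwoCat

/-! ### Fully faithful right 2-adjoints, and full reflective 2-functors on morphisms -/

namespace TwoCat
variable {A : Type u} [Bicategory.{w, v} A] [Strict A] {B : Type u₁} [Bicategory.{w₁, v₁} B]
  [Strict B] {F : StrictPseudofunctor B A} {G : StrictPseudofunctor A B}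

/-- A fully faithful right 2-adjoint is pre-Kock-Zöberlein. -/
lemma TwoAdjunction.isPreKockZoberlein_of_isFullyFaithful (adj : TwoAdjunction F G)
    (hG : IsFullyFaithful G) : adj.IsPreKockZoberlein := by
  refine ⟨?_, fun x x' => ⟨⟨fun f g h => ?_, fun k => ?_⟩, fun f g => ⟨fun θ φ h => ?_,
    fun κ => ?_⟩⟩⟩
  -- Fullness gives `k` with `G k = η_{Gx}`. Transposition shows `ε_x ≫ k = 𝟙`, and applying `G`
  -- gives the claim.
  · have hμ : ∀ x : A, G.map (adj.counitApp x) ≫ adj.unitApp (G.obj x) = 𝟙 _ := fun x => by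
      obtain ⟨k, hk⟩ := (hG x (F.obj (G.obj x))).1.2 (adj.unitApp (G.obj x))
      dsimp only at hk
      have e : adj.counitApp x ≫ k = 𝟙 _ := adj.hom_ext_of_unitApp (by
        rw [G.map_comp, unitApp_map_counitApp_assoc, hk, G.map_id, Strict.comp_id])
      rw [← hk, ← G.map_comp, e, G.map_id]
    have hM : ∀ x : B, 𝟙 (adj.monad.T.obj (adj.monad.T.obj x)) =
      adj.monad.multApp x ≫ adj.monad.unitApp (adj.monad.T.obj x) := fun x => (hμ (F.obj x)).symm
    refine ⟨fun x => eqToHom (hM x), fun f => ?_, fun x => ?_, fun x => ?_⟩ <;>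
      refine Cell.of_injective ?_
    · simp only [Cell.of_eqToHom_comp, Cell.of_comp_eqToHom, Cell.of_whiskerLeft,
        Cell.of_whiskerRight, Cell.of_eqToHom, Cell.wl_id, Cell.id_wr, Strict.id_comp,
        Strict.comp_id]
    · rw [Cell.of_eqToHom, Cell.of_whiskerLeft, Cell.of_eqToHom, Cell.wl_id]
    · rw [Cell.of_eqToHom, Cell.of_whiskerRight, Cell.of_eqToHom, Cell.id_wr]
  · exact (hG x x').1.1 (congrArg TwoMonad.Algebra.Hom.map h)
  · obtain ⟨g, hg⟩ := (hG x x').1.2 k.map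
    exact ⟨g, TwoMonad.Algebra.hom_ext hg⟩
  · exact ((hG x x').2 f g).1 (congrArg TwoMonad.Algebra.Hom₂.cell h)
  · obtain ⟨θ, hθ⟩ := ((hG x x').2 f g).2 κ.cell
    exact ⟨θ, TwoMonad.Algebra.hom₂_ext hθ⟩

/-- The usual argument that an equivalence is fully faithful, here for 1-cells only. -/
lemma IsTwoEquivalence.map_bijective {H : StrictPseudofunctor A B} (h : IsTwoEquivalence H)
    (x x' : A) : Function.Bijective (fun f : x ⟶ x' => H.map f) := by
  obtain ⟨E, α, β, ⟨α', hα⟩, ⟨β', hβ⟩⟩ := h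
  obtain ⟨p, p', nat, hp, hp'⟩ : ∃ (p : ∀ a, a ⟶ E.obj (H.obj a)) (p' : ∀ a, E.obj (H.obj a) ⟶ a),
      (∀ {a b : A} (f : a ⟶ b), f ≫ p b = p a ≫ E.map (H.map f)) ∧
      (∀ a, p a ≫ p' a = 𝟙 _) ∧ ∀ a, p' a ≫ p a = 𝟙 _ :=
    ⟨α.app, α'.app, α.naturality, fun a => (hα a).1, fun a => (hα a).2⟩
  obtain ⟨q, q', nat', hq'⟩ : ∃ (q : ∀ b, H.obj (E.obj b) ⟶ b) (q' : ∀ b, b ⟶ H.obj (E.obj b)),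
      (∀ {a b : B} (f : a ⟶ b), H.map (E.map f) ≫ q b = q a ≫ f) ∧ ∀ b, q' b ≫ q b = 𝟙 _ :=
    ⟨β.app, β'.app, β.naturality, fun a => (hβ a).2⟩
  have inj : ∀ {a b : B} {f g : a ⟶ b}, E.map f = E.map g → f = g := fun {a b f g} e => by
    rw [← Strict.id_comp f, ← Strict.id_comp g, ← hq', Strict.assoc, Strict.assoc, ← nat',
      ← nat', e]
  -- The preimage of `k` is `E k` conjugated by the unit isomorphism. Naturality shows that `E ∘ H`
  -- sends it to `E k`, and `E` is faithful.
  refine ⟨fun f g e => ?_, fun k => ⟨p x ≫ E.map k ≫ p' x', inj ?_⟩⟩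
  · dsimp only at e
    rw [← Strict.comp_id f, ← Strict.comp_id g, ← hp, ← Strict.assoc, ← Strict.assoc, nat, nat, e]
  · dsimp only
    rw [← Strict.id_comp (E.map (H.map _)), ← hp', Strict.assoc, ← nat, Strict.assoc, Strict.assoc,
      hp', Strict.comp_id, ← Strict.assoc, hp', Strict.id_comp]

/-- Every morphism between algebras of an idempotent 2-monad is an algebra morphism. -/
lemma TwoMonad.IsIdempotent.map_str_eq {M : TwoMonad B} (hM : M.IsIdempotent) (X Y : M.Algebra)
    (f : X.carrier ⟶ Y.carrier) : M.T.map f ≫ Y.str = X.str ≫ f := by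
  obtain ⟨ν, hν⟩ : ∃ ν : ∀ x, M.T.obj x ⟶ M.T.obj (M.T.obj x), ∀ x, M.multApp x ≫ ν x = 𝟙 _ :=
    hM.elim fun ν hν => ⟨ν.app, fun x => (hν x).1⟩
  -- A right inverse of `μ` must equal `ηT`, because `ηT ≫ μ = 𝟙`.
  have hμ : ∀ x, M.multApp x ≫ M.unitApp (M.T.obj x) = 𝟙 _ := fun x => by
    have h : M.unitApp (M.T.obj x) = ν x := by
      rw [← Strict.comp_id (M.unitApp _), ← hν, ← Strict.assoc, M.unitApp_multApp, Strict.id_comp]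
    rw [h, hν]
  have hT : ∀ x, M.T.map (M.unitApp x) = M.unitApp (M.T.obj x) := fun x => by
    have h₁ : M.T.map (M.unitApp x) ≫ M.multApp x = 𝟙 _ := M.map_unit_mult x
    rw [← Strict.id_comp (M.unitApp (M.T.obj x)), ← h₁, Strict.assoc, hμ]
    exact (Strict.comp_id _).symm
  -- Every structure map is inverse to the unit, so its compatibility with any morphism reduces to
  -- naturality of `η`.
  have hX : X.str ≫ M.unitApp X.carrier = 𝟙 _ := by
    rw [unitApp_naturality, ← hT, ← M.T.map_comp, X.unit_str, M.T.map_id]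
  calc M.T.map f ≫ Y.str = (X.str ≫ M.unitApp X.carrier) ≫ M.T.map f ≫ Y.str := by
        rw [hX, Strict.id_comp]
    _ = X.str ≫ f ≫ M.unitApp Y.carrier ≫ Y.str := by
        rw [Strict.assoc, ← Strict.assoc (M.unitApp X.carrier), ← unitApp_naturality, Strict.assoc]
    _ = X.str ≫ f := by rw [Y.unit_str, Strict.comp_id]

/-- A full reflective 2-functor is bijective on morphisms. -/
lemma IsFullReflective.map_bijective (hG : IsFullReflective G) (x x' : A) :
    Function.Bijective (fun f : x ⟶ x' => G.map f) := by
  obtain ⟨F, adj, hi, hm⟩ := hG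
  have h := IsTwoEquivalence.map_bijective hm x x'
  refine ⟨fun f g e => h.1 (TwoMonad.Algebra.hom_ext e), fun k => ?_⟩
  -- Over an idempotent 2-monad `k` is automatically an algebra morphism, so fullness of the
  -- comparison applies to it.
  obtain ⟨f, hf⟩ := h.2 ⟨k, TwoMonad.IsIdempotent.map_str_eq hi (adj.comparison.obj x)
    (adj.comparison.obj x') k⟩
  exact ⟨f, congrArg TwoMonad.Algebra.Hom.map hf⟩

end TwoCat

/-! ### Bundled 2-cells in lax comma 2-categories and in comma objects -/

namespace TwoCat

section
variable {A : Type u} [Bicategory.{w, v} A] [Strict A]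

namespace Cell

lemma vc_congr {a b : A} {x y x' y' : Cell a b} (hx : x = x') (hy : y = y') (h) :
    vc x y h = vc x' y' (hx ▸ hy ▸ h) := by
  subst hx hy; rfl

lemma vc_eq_right {a b : A} {x y : Cell a b} {f : a ⟶ b} (hx : x = id f) (h) : vc x y h = y := by
  subst hx; exact id_vc f y h

lemma vc_eq_left {a b : A} {x y : Cell a b} {f : a ⟶ b} (hy : y = id f) (h) : vc x y h = x := by
  subst hy; exact vc_id f x h

end Cell

namespace LaxComma
variable {y : A}

/-- The 2-cell of a morphism of `A // y`, bundled. -/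
def Hom.bundledCell {X Y : LaxComma y} (f : X ⟶ Y) : Cell X.left y := Cell.of f.cell

@[simp] lemma Hom.bundledCell_src {X Y : LaxComma y} (f : X ⟶ Y) :
    (Hom.bundledCell f).src = f.map ≫ Y.hom := rfl
@[simp] lemma Hom.bundledCell_tgt {X Y : LaxComma y} (f : X ⟶ Y) :
    (Hom.bundledCell f).tgt = X.hom := rfl

lemma hom_ext_of {X Y : LaxComma y} {f g : X ⟶ Y} (h : f.map = g.map)
    (h' : Hom.bundledCell f = Hom.bundledCell g) : f = g :=
  hom_ext h (Cell.of_injective (by rw [Cell.of_eqToHom_comp]; exact h'))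

lemma bundledCell_id (X : LaxComma y) : Hom.bundledCell (𝟙 X) = Cell.id X.hom := by
  rw [Hom.bundledCell, id_cell, Strict.leftUnitor_eqToIso, eqToIso.hom, Cell.of_eqToHom]
  exact congrArg Cell.id (Strict.id_comp _)

lemma wl_bundledCell_tgt {X Y Z : LaxComma y} (f : X ⟶ Y) (g : Y ⟶ Z) :
    ((Hom.bundledCell g).wl f.map).tgt = (Hom.bundledCell f).src := rfl

lemma bundledCell_comp {X Y Z : LaxComma y} (f : X ⟶ Y) (g : Y ⟶ Z) :
    Hom.bundledCell (f ≫ g) =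
      ((Hom.bundledCell g).wl f.map).vc (Hom.bundledCell f) (wl_bundledCell_tgt f g) := by
  rw [Hom.bundledCell, comp_cell, Strict.associator_eqToIso, eqToIso.hom, Cell.of_eqToHom_comp,
    Cell.of_comp]
  rfl

lemma wr_of_tgt {X Y : LaxComma y} {f g : X ⟶ Y} (θ : f.map ⟶ g.map) :
    ((Cell.of θ).wr Y.hom).tgt = (Hom.bundledCell g).src := rfl

lemma Hom₂.bundled_w {X Y : LaxComma y} {f g : X ⟶ Y} (θ : f ⟶ g) :
    ((Cell.of θ.cell).wr Y.hom).vc (Hom.bundledCell g) (wr_of_tgt θ.cell) = Hom.bundledCell f :=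
  (Cell.of_comp _ _).symm.trans (congrArg Cell.of θ.w)

lemma hom₂_w {X Y : LaxComma y} {f g : X ⟶ Y} {θ : f.map ⟶ g.map}
    (h : ((Cell.of θ).wr Y.hom).vc (Hom.bundledCell g) (wr_of_tgt θ) = Hom.bundledCell f) :
    θ ▷ Y.hom ≫ g.cell = f.cell :=
  Cell.of_injective (by rw [Cell.of_comp]; exact h)

/-- Lets 2-cells of `A // y` whose boundaries are only propositionally equal be compared through
their underlying cells. -/
lemma of_eq_of {X Y : LaxComma y} {f g f' g' : X ⟶ Y} (hf : f = f') (hg : g = g') {θ : f ⟶ g}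
    {θ' : f' ⟶ g'} (h : Cell.of θ.cell = Cell.of θ'.cell) : Cell.of θ = Cell.of θ' := by
  subst hf hg
  exact congrArg Cell.of (hom₂_ext (Cell.of_injective h))

end LaxComma

namespace CommaObject
variable {x w y : A} {a : x ⟶ y} {b : w ⟶ y} (P : CommaObject a b)

/-- The universal 2-cell, bundled. -/
def bundledCell : Cell P.pt y := Cell.of P.cell

@[simp] lemma bundledCell_src : P.bundledCell.src = P.fst ≫ a := rfl
@[simp] lemma bundledCell_tgt : P.bundledCell.tgt = P.snd ≫ b := rfl

/-- The morphism into a comma object induced by a bundled 2-cell. -/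
noncomputable def liftCell {z : A} (h₀ : z ⟶ x) (h₁ : z ⟶ w) (β : Cell z y) (e₀ : h₀ ≫ a = β.src)
    (e₁ : h₁ ≫ b = β.tgt) : z ⟶ P.pt :=
  P.lift h₀ h₁ (β.cast e₀ e₁)

variable {z : A} (h₀ : z ⟶ x) (h₁ : z ⟶ w) (β : Cell z y) (e₀ : h₀ ≫ a = β.src)
    (e₁ : h₁ ≫ b = β.tgt)

lemma liftCell_fst : P.liftCell h₀ h₁ β e₀ e₁ ≫ P.fst = h₀ := P.lift_fst _ _ _

lemma liftCell_snd : P.liftCell h₀ h₁ β e₀ e₁ ≫ P.snd = h₁ := P.lift_snd _ _ _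

lemma wl_liftCell_bundledCell : P.bundledCell.wl (P.liftCell h₀ h₁ β e₀ e₁) = β := by
  refine (congrArg Cell.of (P.lift_cell h₀ h₁ (β.cast e₀ e₁))).trans ?_
  simp only [Cell.of_eqToHom_comp, Cell.of_comp_eqToHom, Cell.of_cast]

lemma hom_ext_of {h h' : z ⟶ P.pt} (e₀ : h ≫ P.fst = h' ≫ P.fst)
    (e₁ : h ≫ P.snd = h' ≫ P.snd) (e : P.bundledCell.wl h = P.bundledCell.wl h') : h = h' := by
  refine P.hom_ext e₀ e₁ (Cell.of_injective ?_)
  simp only [Cell.of_eqToHom_comp, Cell.of_comp_eqToHom]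
  exact e

lemma cell_ext {c c' : Cell z P.pt} (hs : c.src = c'.src) (ht : c.tgt = c'.tgt)
    (e₀ : c.wr P.fst = c'.wr P.fst) (e₁ : c.wr P.snd = c'.wr P.snd) : c = c' := by
  obtain ⟨s, t, c⟩ := c
  obtain ⟨s', t', c'⟩ := c'
  dsimp at hs ht
  subst hs ht
  exact congrArg Cell.of (P.hom₂_ext (Cell.of_injective e₀) (Cell.of_injective e₁))

end CommaObject

end

/-! ### The left 2-adjoint `B / y ⟶ A // F y`, for a general 2-functor -/

section
variable {A : Type u} [Bicategory.{w, v} A] [Strict A] {B : Type u₁} [Bicategory.{w₁, v₁} B]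
  [Strict B]

@[reducible]
def StrictComma.toLax (F : StrictPseudofunctor A B) {y : A} (X : StrictComma y) :
    LaxComma (F.obj y) := ⟨F.obj X.left, F.map X.hom⟩

lemma StrictComma.map_w (F : StrictPseudofunctor A B) {y : A} {X Y : StrictComma y} (f : X ⟶ Y) :
    F.map f.map ≫ F.map Y.hom = F.map X.hom := by
  rw [← F.map_comp, f.w]

def StrictComma.toLaxMap (F : StrictPseudofunctor A B) {y : A} {X Y : StrictComma y} (f : X ⟶ Y) :
    X.toLax F ⟶ Y.toLax F := LaxComma.Hom.mk (F.map f.map) (eqToHom (map_w F f))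

@[simp] lemma StrictComma.toLaxMap_map (F : StrictPseudofunctor A B) {y : A} {X Y : StrictComma y}
    (f : X ⟶ Y) : (toLaxMap F f).map = F.map f.map := rfl

-- The image consists of strict morphisms. The later arguments for lax idempotence and for the
-- splitting both rely on this.
@[simp] lemma StrictComma.bundledCell_toLaxMap (F : StrictPseudofunctor A B) {y : A}
    {X Y : StrictComma y} (f : X ⟶ Y) :
    LaxComma.Hom.bundledCell (toLaxMap F f) = Cell.id (F.map X.hom) :=
  (Cell.of_eqToHom (map_w F f)).trans (congrArg Cell.id (map_w F f))

lemma StrictComma.wr_cell {y : A} {X Y : StrictComma y} {f g : X ⟶ Y} (θ : f ⟶ g) :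
    (Cell.of θ.cell).wr Y.hom = Cell.id X.hom := by
  rw [← Cell.of_whiskerRight, whiskerRight_w, Cell.of_eqToHom, f.w]

def StrictComma.toLaxMap₂ (F : StrictPseudofunctor A B) {y : A} {X Y : StrictComma y} {f g : X ⟶ Y}
    (θ : f ⟶ g) : toLaxMap F f ⟶ toLaxMap F g :=
  LaxComma.Hom₂.mk (F.map₂ θ.cell) (LaxComma.hom₂_w (by
    refine (Cell.vc_eq_left (bundledCell_toLaxMap F g) _).trans ?_
    rw [bundledCell_toLaxMap]
    change ((Cell.of θ.cell).map F).wr (F.map Y.hom) = Cell.id (F.map X.hom)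
    rw [← Cell.map_wr, wr_cell, Cell.map_id]))

@[simp] lemma StrictComma.toLaxMap₂_cell (F : StrictPseudofunctor A B) {y : A}
    {X Y : StrictComma y} {f g : X ⟶ Y} (θ : f ⟶ g) : (toLaxMap₂ F θ).cell = F.map₂ θ.cell := rfl

/-- The 2-functor `A / y ⟶ B // F y` defined pointwise by `F`. -/
def strictCommaToLax (F : StrictPseudofunctor A B) (y : A) :
    StrictPseudofunctor (StrictComma y) (LaxComma (F.obj y)) :=
  StrictPseudofunctor.mk''
  { obj := StrictComma.toLax F
    map := StrictComma.toLaxMap F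
    map₂ := StrictComma.toLaxMap₂ F
    map₂_id := fun f => LaxComma.hom₂_ext (F.map₂_id f.map)
    map₂_comp := fun θ φ => LaxComma.hom₂_ext (F.map₂_comp θ.cell φ.cell)
    map_id := fun X => LaxComma.hom_ext_of (F.map_id X.left) (by
      rw [LaxComma.bundledCell_id, StrictComma.bundledCell_toLaxMap])
    map_comp := fun {X Y Z} f g => LaxComma.hom_ext_of (F.map_comp f.map g.map) (by
      rw [LaxComma.bundledCell_comp,
        Cell.vc_eq_left (StrictComma.bundledCell_toLaxMap F f),
        StrictComma.bundledCell_toLaxMap, StrictComma.bundledCell_toLaxMap, Cell.wl_id,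
        StrictComma.toLaxMap_map, StrictComma.map_w])
    map₂_whisker_left := fun f _ _ θ => LaxComma.hom₂_ext (by
      simpa using map₂_whiskerLeft_eq F f.map θ.cell)
    map₂_whisker_right := fun θ g => LaxComma.hom₂_ext (by
      simpa using map₂_whiskerRight_eq F θ.cell g.map) }

end

/-! ### The 2-adjunction between `B / y` and `A // F y`, without any admissibility -/

namespace TwoAdjunction
variable {A : Type u} [Bicategory.{w, v} A] [Strict A] {B : Type u₁} [Bicategory.{w₁, v₁} B]
  [Strict B] {F : StrictPseudofunctor B A} {G : StrictPseudofunctor A B} (adj : TwoAdjunction F G)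
  {y : B} (K : CommaObjectsAlong (adj.unitApp y))

/-- The comma object `G a ↓ η_y`. -/
def commaObj (X : LaxComma (F.obj y)) : CommaObject (G.map X.hom) (adj.unitApp y) := K (G.map X.hom)

noncomputable def commaMap {X Y : LaxComma (F.obj y)} (f : X ⟶ Y) :
    (adj.commaObj K X).pt ⟶ (adj.commaObj K Y).pt :=
  commaBaseChangeMap K ((laxCommaLift G (F.obj y)).map f)

lemma commaMap_fst {X Y : LaxComma (F.obj y)} (f : X ⟶ Y) :
    adj.commaMap K f ≫ (adj.commaObj K Y).fst = (adj.commaObj K X).fst ≫ G.map f.map :=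
  commaBaseChangeMap_fst K ((laxCommaLift G (F.obj y)).map f)

lemma commaMap_snd {X Y : LaxComma (F.obj y)} (f : X ⟶ Y) :
    adj.commaMap K f ≫ (adj.commaObj K Y).snd = (adj.commaObj K X).snd :=
  commaBaseChangeMap_snd K ((laxCommaLift G (F.obj y)).map f)

/-- The object `(G a ↓ η_y, q)` of `B / y`. -/
@[reducible]
def commaProj (X : LaxComma (F.obj y)) : StrictComma y :=
  ⟨(adj.commaObj K X).pt, (adj.commaObj K X).snd⟩

noncomputable def commaProjMap {X Y : LaxComma (F.obj y)} (f : X ⟶ Y) :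
    adj.commaProj K X ⟶ adj.commaProj K Y :=
  StrictComma.Hom.mk (adj.commaMap K f) (adj.commaMap_snd K f)

@[simp] lemma commaProjMap_map {X Y : LaxComma (F.obj y)} (f : X ⟶ Y) :
    (adj.commaProjMap K f).map = adj.commaMap K f := rfl

lemma wl_map_bundledCell_tgt {X Y : LaxComma (F.obj y)} (f : X ⟶ Y) :
    (((LaxComma.Hom.bundledCell f).map G).wl (adj.commaObj K X).fst).tgt =
      (adj.commaObj K X).bundledCell.src := rfl

lemma commaMap_bundledCell {X Y : LaxComma (F.obj y)} (f : X ⟶ Y) :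
    (adj.commaObj K Y).bundledCell.wl (adj.commaMap K f) =
      (((LaxComma.Hom.bundledCell f).map G).wl (adj.commaObj K X).fst).vc
        (adj.commaObj K X).bundledCell (adj.wl_map_bundledCell_tgt K f) := by
  refine (congrArg Cell.of
    (commaBaseChangeMap_cell K ((laxCommaLift G (F.obj y)).map f))).trans ?_
  rw [Cell.of_eqToHom_comp]
  refine (Cell.of_comp _ _).trans (Cell.vc_congr ?_ (Cell.of_comp_eqToHom _ _) _)
  exact congrArg (Cell.wl (adj.commaObj K X).fst) (Cell.of_eqToHom_comp _ _)

noncomputable def commaProjMap₂ {X Y : LaxComma (F.obj y)} {f g : X ⟶ Y} (θ : f ⟶ g) :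
    adj.commaProjMap K f ⟶ adj.commaProjMap K g :=
  StrictComma.homMk₂ (commaBaseChangeMap₂ K ((laxCommaLift G (F.obj y)).map₂ θ))
    (commaBaseChangeMap₂_snd K ((laxCommaLift G (F.obj y)).map₂ θ))

noncomputable def commaMap₂ {X Y : LaxComma (F.obj y)} {f g : X ⟶ Y} (θ : f ⟶ g) :
    Cell (adj.commaObj K X).pt (adj.commaObj K Y).pt :=
  Cell.of (adj.commaProjMap₂ K θ).cell

lemma commaMap₂_fst {X Y : LaxComma (F.obj y)} {f g : X ⟶ Y} (θ : f ⟶ g) :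
    (adj.commaMap₂ K θ).wr (adj.commaObj K Y).fst =
      ((Cell.of θ.cell).map G).wl (adj.commaObj K X).fst := by
  refine (congrArg Cell.of
    (commaBaseChangeMap₂_fst K ((laxCommaLift G (F.obj y)).map₂ θ))).trans ?_
  rw [Cell.of_eqToHom_comp, Cell.of_comp_eqToHom]
  rfl

lemma commaMap₂_snd {X Y : LaxComma (F.obj y)} {f g : X ⟶ Y} (θ : f ⟶ g) :
    (adj.commaMap₂ K θ).wr (adj.commaObj K Y).snd = Cell.id (adj.commaObj K X).snd := by
  refine (congrArg Cell.of
    (commaBaseChangeMap₂_snd K ((laxCommaLift G (F.obj y)).map₂ θ))).trans ?_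
  rw [Cell.of_eqToHom]
  exact congrArg Cell.id (adj.commaMap_snd K f)

/-- The unit of the 2-adjunction between `y ↦ F y` and the comma objects along `η_y`. -/
noncomputable def commaUnit (X : StrictComma y) :
    X.left ⟶ (adj.commaObj K (X.toLax F)).pt :=
  (adj.commaObj K (X.toLax F)).liftCell (adj.unitApp X.left) X.hom
    (Cell.id (X.hom ≫ adj.unitApp y)) (adj.unitApp_naturality X.hom).symm rfl

lemma commaUnit_fst (X : StrictComma y) :
    adj.commaUnit K X ≫ (adj.commaObj K (X.toLax F)).fst = adj.unitApp X.left :=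
  CommaObject.liftCell_fst _ _ _ _ _ _

lemma commaUnit_snd (X : StrictComma y) :
    adj.commaUnit K X ≫ (adj.commaObj K (X.toLax F)).snd = X.hom :=
  CommaObject.liftCell_snd _ _ _ _ _ _

lemma commaUnit_bundledCell (X : StrictComma y) :
    (adj.commaObj K (X.toLax F)).bundledCell.wl (adj.commaUnit K X) =
      Cell.id (X.hom ≫ adj.unitApp y) :=
  CommaObject.wl_liftCell_bundledCell _ _ _ _ _ _

/-- The transpose of the first projection. `commaCounitCell` is likewise the transpose of the
universal 2-cell. -/
def commaCounitMap (X : LaxComma (F.obj y)) : F.obj (adj.commaObj K X).pt ⟶ X.left :=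
  F.map (adj.commaObj K X).fst ≫ adj.counitApp X.left

def commaCounitCell (X : LaxComma (F.obj y)) : Cell (F.obj (adj.commaObj K X).pt) (F.obj y) :=
  ((adj.commaObj K X).bundledCell.map F).wr (adj.counitApp (F.obj y))

lemma commaCounitCell_src (X : LaxComma (F.obj y)) :
    (adj.commaCounitCell K X).src = adj.commaCounitMap K X ≫ X.hom := by
  simp [commaCounitCell, commaCounitMap, F.map_comp, counitApp_naturality]

/-- The left triangle identity cancels `F η_y` against `ε_{Fy}`, so the cell ends at `F` of the
second projection, as a morphism of `A // F y` requires. -/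
lemma commaCounitCell_tgt (X : LaxComma (F.obj y)) :
    (adj.commaCounitCell K X).tgt = F.map (adj.commaObj K X).snd := by
  simp [commaCounitCell, F.map_comp, map_unitApp_counitApp]

/-- The counit of the 2-adjunction between `y ↦ F y` and the comma objects along `η_y`. -/
def commaCounit (X : LaxComma (F.obj y)) : (adj.commaProj K X).toLax F ⟶ X where
  map := adj.commaCounitMap K X
  cell := (adj.commaCounitCell K X).cast (adj.commaCounitCell_src K X).symm
    (adj.commaCounitCell_tgt K X).symm

lemma bundledCell_commaCounit (X : LaxComma (F.obj y)) :
    LaxComma.Hom.bundledCell (adj.commaCounit K X) = adj.commaCounitCell K X :=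
  Cell.of_cast _ (adj.commaCounitCell_src K X).symm (adj.commaCounitCell_tgt K X).symm

@[simp] lemma commaCounit_map (X : LaxComma (F.obj y)) :
    (adj.commaCounit K X).map = adj.commaCounitMap K X := rfl

lemma commaUnit_naturality {X Y : StrictComma y} (f : X ⟶ Y) :
    f.map ≫ adj.commaUnit K Y = adj.commaUnit K X ≫ adj.commaMap K (StrictComma.toLaxMap F f) := by
  refine CommaObject.hom_ext_of _ ?_ ?_ ?_
  · rw [Strict.assoc, Strict.assoc, commaUnit_fst, commaMap_fst,
      ← Strict.assoc (commaUnit _ _ _), commaUnit_fst]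
    exact adj.unitApp_naturality f.map
  · rw [Strict.assoc, Strict.assoc, commaUnit_snd, commaMap_snd, commaUnit_snd, f.w]
  · rw [← Cell.wl_wl, ← Cell.wl_wl, commaUnit_bundledCell, commaMap_bundledCell, Cell.wl_id,
      ← Strict.assoc, f.w]
    refine ((congrArg (Cell.wl _) (Cell.vc_eq_right
      (f := (adj.commaObj K _).fst ≫ G.map (F.map X.hom)) ?_ _)).trans
        (adj.commaUnit_bundledCell K X)).symm
    rw [StrictComma.bundledCell_toLaxMap, Cell.map_id, Cell.wl_id]

lemma commaCounit_naturality {X Y : LaxComma (F.obj y)} (f : X ⟶ Y) :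
    StrictComma.toLaxMap F (adj.commaProjMap K f) ≫ adj.commaCounit K Y =
      adj.commaCounit K X ≫ f := by
  refine LaxComma.hom_ext_of ?_ ?_
  · simp only [LaxComma.comp_map, StrictComma.toLaxMap_map, commaCounit_map, commaCounitMap,
      commaProjMap_map]
    rw [← Strict.assoc, ← F.map_comp, commaMap_fst, F.map_comp, Strict.assoc, Strict.assoc,
      counitApp_naturality]
  · rw [LaxComma.bundledCell_comp, LaxComma.bundledCell_comp,
      Cell.vc_eq_left (StrictComma.bundledCell_toLaxMap F _)]
    simp only [bundledCell_commaCounit, commaCounit_map, StrictComma.toLaxMap_map,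
      commaProjMap_map, commaCounitCell]
    rw [← Cell.wr_wl, ← Cell.map_wl, commaMap_bundledCell, Cell.map_vc, Cell.wr_vc]
    refine Cell.vc_congr ?_ rfl _
    rw [Cell.map_wl, Cell.wr_wl, cell_counitApp_naturality, Cell.wl_wl, commaCounitMap]

@[reducible]
noncomputable def commaUnitHom (X : StrictComma y) : X ⟶ adj.commaProj K (X.toLax F) :=
  StrictComma.Hom.mk (adj.commaUnit K X) (adj.commaUnit_snd K X)

lemma toLaxMap_commaUnit_commaCounit (X : StrictComma y) :
    StrictComma.toLaxMap F (adj.commaUnitHom K X) ≫ adj.commaCounit K (X.toLax F) = 𝟙 _ := by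
  refine LaxComma.hom_ext_of ?_ ?_
  · simp only [LaxComma.comp_map, StrictComma.toLaxMap_map, commaCounit_map, commaCounitMap,
      LaxComma.id_map]
    rw [← Strict.assoc, ← F.map_comp, commaUnit_fst]
    exact adj.map_unitApp_counitApp X.left
  · rw [LaxComma.bundledCell_comp, LaxComma.bundledCell_id,
      Cell.vc_eq_left (StrictComma.bundledCell_toLaxMap F _), bundledCell_commaCounit,
      commaCounitCell, StrictComma.toLaxMap_map, ← Cell.wr_wl, ← Cell.map_wl,
      commaUnit_bundledCell, Cell.map_id, Cell.id_wr, F.map_comp, Strict.assoc,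
      map_unitApp_counitApp, Strict.comp_id]

/-- By the universal property of the comma object: on the first projection and on the universal
2-cell, the composite transposes twice. -/
lemma commaUnit_commaMap_commaCounit (X : LaxComma (F.obj y)) :
    adj.commaUnit K (adj.commaProj K X) ≫ adj.commaMap K (adj.commaCounit K X) = 𝟙 _ := by
  refine CommaObject.hom_ext_of _ ?_ ?_ ?_
  · rw [Strict.assoc, commaMap_fst, ← Strict.assoc, commaUnit_fst, commaCounit_map, commaCounitMap,
      G.map_comp, ← adj.unitApp_naturality_assoc, unitApp_map_counitApp, Strict.id_comp,
      Strict.comp_id]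
  · rw [Strict.assoc, commaMap_snd, commaUnit_snd, Strict.id_comp]
  · rw [← Cell.wl_wl, commaMap_bundledCell, Cell.id_wl, Cell.wl_vc,
      Cell.vc_eq_left (adj.commaUnit_bundledCell K _), Cell.wl_wl, commaUnit_fst,
      bundledCell_commaCounit, commaCounitCell, cell_unit_transpose]

lemma cell_commaUnit_naturality {X Y : StrictComma y} {f g : X ⟶ Y} (θ : f ⟶ g) :
    (Cell.of θ.cell).wr (adj.commaUnit K Y) =
      (adj.commaMap₂ K (StrictComma.toLaxMap₂ F θ)).wl (adj.commaUnit K X) := by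
  refine CommaObject.cell_ext _ (adj.commaUnit_naturality K f) (adj.commaUnit_naturality K g) ?_ ?_
  · rw [Cell.wr_wr, Cell.wr_wl, commaUnit_fst, commaMap₂_fst, Cell.wl_wl, commaUnit_fst]
    exact adj.cell_unitApp_naturality _
  · rw [Cell.wr_wr, Cell.wr_wl, commaUnit_snd, StrictComma.wr_cell, commaMap₂_snd, Cell.wl_id,
      commaUnit_snd]

lemma cell_commaCounit_naturality {X Y : LaxComma (F.obj y)} {f g : X ⟶ Y} (θ : f ⟶ g) :
    ((adj.commaMap₂ K θ).map F).wr (adj.commaCounitMap K Y) =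
      (Cell.of θ.cell).wl (adj.commaCounitMap K X) := by
  rw [commaCounitMap, ← Cell.wr_wr, ← Cell.map_wr, commaMap₂_fst, Cell.map_wl, Cell.wr_wl,
    cell_counitApp_naturality, Cell.wl_wl]
  rfl

lemma commaCounit_naturality₂ {X Y : LaxComma (F.obj y)} {f g : X ⟶ Y} (θ : f ⟶ g) :
    StrictComma.toLaxMap₂ F (adj.commaProjMap₂ K θ) ▷ adj.commaCounit K Y =
      eqToHom (adj.commaCounit_naturality K f) ≫ adj.commaCounit K X ◁ θ ≫
        eqToHom (adj.commaCounit_naturality K g).symm :=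
  Cell.of_injective (by
    rw [Cell.of_eqToHom_comp, Cell.of_comp_eqToHom]
    exact LaxComma.of_eq_of (adj.commaCounit_naturality K f) (adj.commaCounit_naturality K g)
      (adj.cell_commaCounit_naturality K θ))

/-- The 2-adjunction `A // F y ⇄ B / y` given by `F` and the comma objects along `η_y`. -/
noncomputable def commaAdjunction : TwoAdjunction (strictCommaToLax F y)
    ((laxCommaLift G (F.obj y)).comp (commaBaseChange K)) where
  unit :=
    { app := adj.commaUnitHom K
      naturality := fun f => StrictComma.hom_ext (adj.commaUnit_naturality K f)
      naturality₂ := fun θ => StrictComma.hom₂_ext (Cell.of_injective (by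
        simp only [StrictComma.comp₂_cell, StrictComma.eqToHom_cell, Cell.of_comp_eqToHom,
          Cell.of_eqToHom_comp]
        exact adj.cell_commaUnit_naturality K θ)) }
  counit :=
    { app := adj.commaCounit K
      naturality := adj.commaCounit_naturality K
      naturality₂ := adj.commaCounit_naturality₂ K }
  left_triangle := adj.toLaxMap_commaUnit_commaCounit K
  right_triangle X := StrictComma.hom_ext (adj.commaUnit_commaMap_commaCounit K X)

end TwoAdjunction
end TwoCat

/-! ### Consequences of admissibility: `F (G a ↓ η_y)` as a comma object in `A` -/

namespace TwoCat

/-- The two-dimensional universal property with boundaries matched only up to equality, so that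
2-cells can be supplied in whatever form they arise. -/
lemma CommaObject.exists_cell {A : Type u} [Bicategory.{w, v} A] [Strict A] {x w y z : A}
    {a : x ⟶ y} {b : w ⟶ y} (P : CommaObject a b) (h h' : z ⟶ P.pt) (ξ₀ : Cell z x) (ξ₁ : Cell z w)
    (hs₀ : ξ₀.src = h ≫ P.fst) (ht₀ : ξ₀.tgt = h' ≫ P.fst) (hs₁ : ξ₁.src = h ≫ P.snd)
    (ht₁ : ξ₁.tgt = h' ≫ P.snd) (e e')
    (H : (ξ₀.wr a).vc (P.bundledCell.wl h') e = (P.bundledCell.wl h).vc (ξ₁.wr b) e') :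
    ∃ ξ : h ⟶ h', (Cell.of ξ).wr P.fst = ξ₀ ∧ (Cell.of ξ).wr P.snd = ξ₁ := by
  obtain ⟨s₀, t₀, ξ₀⟩ := ξ₀
  obtain ⟨s₁, t₁, ξ₁⟩ := ξ₁
  dsimp at hs₀ ht₀ hs₁ ht₁
  subst hs₀ ht₀ hs₁ ht₁
  have E : ξ₀ ▷ a ≫ eqToHom (Strict.assoc _ _ _) ≫ h' ◁ P.cell =
      eqToHom (Strict.assoc _ _ _) ≫ h ◁ P.cell ≫ eqToHom (Strict.assoc _ _ _).symm ≫ ξ₁ ▷ b ≫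
        eqToHom (Strict.assoc _ _ _) := by
    refine Cell.of_injective ?_
    rw [Cell.of_eqToHom_comp]
    refine H.trans ?_
    exact Eq.trans (Cell.vc_congr rfl
      ((Cell.of_eqToHom_comp _ _).trans (Cell.of_comp_eqToHom _ _)).symm _) (Cell.of_comp _ _).symm
  exact ⟨P.lift₂ ξ₀ ξ₁ E, congrArg Cell.of (P.lift₂_fst ξ₀ ξ₁ E),
    congrArg Cell.of (P.lift₂_snd ξ₀ ξ₁ E)⟩

namespace TwoAdjunction
variable {A : Type u} [Bicategory.{w, v} A] [Strict A] {B : Type u₁} [Bicategory.{w₁, v₁} B]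
  [Strict B] {F : StrictPseudofunctor B A} {G : StrictPseudofunctor A B} (adj : TwoAdjunction F G)
  {y : B}

section Pullback
variable (P : PullbacksAlong (adj.unitApp y))

def pullbackObj (Z : StrictComma (F.obj y)) : PullbackObject (G.map Z.hom) (adj.unitApp y) :=
  P (G.map Z.hom)

noncomputable def pullbackMap {Y Z : StrictComma (F.obj y)} (f : Y ⟶ Z) :
    (adj.pullbackObj P Y).pt ⟶ (adj.pullbackObj P Z).pt :=
  pullbackBaseChangeMap P ((strictCommaLift G (F.obj y)).map f)

lemma pullbackMap_fst {Y Z : StrictComma (F.obj y)} (f : Y ⟶ Z) :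
    adj.pullbackMap P f ≫ (adj.pullbackObj P Z).fst = (adj.pullbackObj P Y).fst ≫ G.map f.map :=
  pullbackBaseChangeMap_fst P ((strictCommaLift G (F.obj y)).map f)

lemma pullbackMap_snd {Y Z : StrictComma (F.obj y)} (f : Y ⟶ Z) :
    adj.pullbackMap P f ≫ (adj.pullbackObj P Z).snd = (adj.pullbackObj P Y).snd :=
  pullbackBaseChangeMap_snd P ((strictCommaLift G (F.obj y)).map f)

/-- If `η_y^* ∘ Ǧ` is full reflective, the transpose of the first projection of the pullback of
`G Z` along `η_y` is invertible. -/
lemma exists_inv_map_fst_counitApp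
    (hP : TwoCat.IsFullReflective ((strictCommaLift G (F.obj y)).comp (pullbackBaseChange P)))
    (Z : StrictComma (F.obj y)) :
    ∃ k : Z.left ⟶ F.obj (adj.pullbackObj P Z).pt,
      k ≫ F.map (adj.pullbackObj P Z).fst ≫ adj.counitApp Z.left = 𝟙 _ ∧
      (F.map (adj.pullbackObj P Z).fst ≫ adj.counitApp Z.left) ≫ k = 𝟙 _ := by
  let Y : StrictComma (F.obj y) :=
    ⟨F.obj (adj.pullbackObj P Z).pt, F.map (adj.pullbackObj P Z).snd⟩
  let j : Y ⟶ Z := StrictComma.Hom.mk (F.map (adj.pullbackObj P Z).fst ≫ adj.counitApp Z.left) (by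
    rw [Strict.assoc, ← counitApp_naturality, ← Strict.assoc, ← F.map_comp,
      (adj.pullbackObj P Z).condition, F.map_comp, Strict.assoc, map_unitApp_counitApp,
      Strict.comp_id])
  -- The would-be unit at the pullback. It is a morphism over `y` between two values of `η_y^* ∘ Ǧ`,
  -- so fullness provides `k : Z ⟶ Y` inducing it. This `k` is the inverse of `j`.
  let n : (adj.pullbackObj P Z).pt ⟶ (adj.pullbackObj P Y).pt :=
    (adj.pullbackObj P Y).lift (adj.unitApp _) (adj.pullbackObj P Z).snd
      (adj.unitApp_naturality _).symm
  have n_fst : n ≫ (adj.pullbackObj P Y).fst = adj.unitApp _ := PullbackObject.lift_fst _ _ _ _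
  have n_snd : n ≫ (adj.pullbackObj P Y).snd = (adj.pullbackObj P Z).snd :=
    PullbackObject.lift_snd _ _ _ _
  have hj : j.map = F.map (adj.pullbackObj P Z).fst ≫ adj.counitApp Z.left := rfl
  obtain ⟨k, hk⟩ : ∃ k : Z ⟶ Y, adj.pullbackMap P k = n := by
    obtain ⟨k, hk⟩ := (hP.map_bijective Z Y).2 (StrictComma.Hom.mk n n_snd)
    exact ⟨k, congrArg StrictComma.Hom.map hk⟩
  have hnj : adj.unitApp _ ≫ G.map j.map = (adj.pullbackObj P Z).fst := by
    rw [hj, G.map_comp, ← unitApp_naturality_assoc, unitApp_map_counitApp, Strict.comp_id]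
  refine ⟨k.map, ?_, ?_⟩
  -- By faithfulness, `k ≫ j = 𝟙` can be checked after applying `η_y^* ∘ Ǧ`, on the two pullback
  -- projections.
  · refine congrArg StrictComma.Hom.map ((hP.map_bijective Z Z).1 (a₁ := k ≫ j) (a₂ := 𝟙 Z)
      (StrictComma.hom_ext ?_))
    change adj.pullbackMap P (k ≫ j) = adj.pullbackMap P (𝟙 Z)
    refine (adj.pullbackObj P Z).hom_ext ?_ ?_
    · rw [pullbackMap_fst, pullbackMap_fst, StrictComma.comp_map, StrictComma.id_map, G.map_comp,
        ← Strict.assoc, ← pullbackMap_fst, hk, n_fst, hnj, G.map_id, Strict.comp_id]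
    · rw [pullbackMap_snd, pullbackMap_snd]
  -- The transpose of `j ≫ k` is the first projection followed by `G k`, which is `n` followed by
  -- the first projection, namely `η`.
  · refine adj.hom_ext_of_unitApp ?_
    rw [← hj, G.map_comp, ← Strict.assoc, hnj, ← pullbackMap_fst, hk, n_fst, G.map_id,
      Strict.comp_id]

end Pullback

variable (K : CommaObjectsAlong (adj.unitApp y))

/-- The comparison of `F (G a ↓ η_y)` with a comma object of `a` and the identity. -/
noncomputable def commaComparison (X : LaxComma (F.obj y)) (C : CommaObject X.hom (𝟙 (F.obj y))) :
    F.obj (adj.commaObj K X).pt ⟶ C.pt :=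
  C.liftCell (adj.commaCounitMap K X) (F.map (adj.commaObj K X).snd) (adj.commaCounitCell K X)
    (adj.commaCounitCell_src K X).symm (by rw [commaCounitCell_tgt, Strict.comp_id])

section Comparison
variable (X : LaxComma (F.obj y)) (C : CommaObject X.hom (𝟙 (F.obj y)))

lemma commaComparison_fst : adj.commaComparison K X C ≫ C.fst = adj.commaCounitMap K X :=
  CommaObject.liftCell_fst _ _ _ _ _ _

lemma commaComparison_snd :
    adj.commaComparison K X C ≫ C.snd = F.map (adj.commaObj K X).snd :=
  CommaObject.liftCell_snd _ _ _ _ _ _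

lemma wl_commaComparison :
    C.bundledCell.wl (adj.commaComparison K X C) = adj.commaCounitCell K X :=
  CommaObject.wl_liftCell_bundledCell _ _ _ _ _ _

/-- Since `G` is a right 2-adjoint, `G C` is a comma object of `G a` and the identity, and pulling
it back along `η_y` gives `G a ↓ η_y`. So `F (G a ↓ η_y)` is `F` of a pullback of `G C`, which the
previous inverse identifies with `C`. The proof works with transposes and does not isolate
preservation of commas. -/
lemma exists_inv_commaComparison (P : PullbacksAlong (adj.unitApp y))
    (hP : TwoCat.IsFullReflective ((strictCommaLift G (F.obj y)).comp (pullbackBaseChange P))) :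
    ∃ d : C.pt ⟶ F.obj (adj.commaObj K X).pt,
      adj.commaComparison K X C ≫ d = 𝟙 _ ∧ d ≫ adj.commaComparison K X C = 𝟙 _ := by
  let Z : StrictComma (F.obj y) := ⟨C.pt, C.snd⟩
  obtain ⟨k, hk, hk'⟩ := adj.exists_inv_map_fst_counitApp P hP Z
  let Q : PullbackObject (G.map C.snd) (adj.unitApp y) := adj.pullbackObj P Z
  let L : CommaObject (G.map X.hom) (adj.unitApp y) := adj.commaObj K X
  let c : F.obj L.pt ⟶ C.pt := adj.commaComparison K X C
  have c_snd : c ≫ C.snd = F.map L.snd := adj.commaComparison_snd K X C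
  have c_fst : c ≫ C.fst = F.map L.fst ≫ adj.counitApp X.left := adj.commaComparison_fst K X C
  have c_cell : C.bundledCell.wl c = (L.bundledCell.map F).wr (adj.counitApp (F.obj y)) :=
    adj.wl_commaComparison K X C
  change k ≫ F.map Q.fst ≫ adj.counitApp C.pt = 𝟙 _ at hk
  change (F.map Q.fst ≫ adj.counitApp C.pt) ≫ k = 𝟙 _ at hk'
  -- The canonical map from `G a ↓ η_y` to the pullback `Q` of `G C` along `η_y`, by way of the
  -- transpose of `c`. The map `q` below goes back, using the image under `G` of the universal
  -- 2-cell of `C`.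
  let p : L.pt ⟶ Q.pt := Q.lift (adj.unitApp _ ≫ G.map c) L.snd
    (by rw [Strict.assoc, ← G.map_comp, c_snd, unitApp_naturality])
  have p_fst : p ≫ Q.fst = adj.unitApp _ ≫ G.map c := PullbackObject.lift_fst _ _ _ _
  have p_snd : p ≫ Q.snd = L.snd := PullbackObject.lift_snd _ _ _ _
  let q : Q.pt ⟶ L.pt := L.liftCell (Q.fst ≫ G.map C.fst) Q.snd
    ((C.bundledCell.map G).wl Q.fst)
    (by rw [Cell.wl_src, Cell.map_src, CommaObject.bundledCell_src, G.map_comp, Strict.assoc])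
    (by rw [Cell.wl_tgt, Cell.map_tgt, CommaObject.bundledCell_tgt, Strict.comp_id, Q.condition])
  have q_fst : q ≫ L.fst = Q.fst ≫ G.map C.fst := CommaObject.liftCell_fst _ _ _ _ _ _
  have q_snd : q ≫ L.snd = Q.snd := CommaObject.liftCell_snd _ _ _ _ _ _
  have q_cell : L.bundledCell.wl q = (C.bundledCell.map G).wl Q.fst :=
    CommaObject.wl_liftCell_bundledCell _ _ _ _ _ _
  have hpq : p ≫ q = 𝟙 _ := by
    refine L.hom_ext_of ?_ ?_ ?_
    · rw [Strict.assoc, q_fst, ← Strict.assoc, p_fst, Strict.assoc, ← G.map_comp, c_fst,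
        G.map_comp, ← unitApp_naturality_assoc, unitApp_map_counitApp, Strict.id_comp,
        Strict.comp_id]
    · rw [Strict.assoc, q_snd, p_snd, Strict.id_comp]
    · rw [← Cell.wl_wl, q_cell, Cell.wl_wl, p_fst, ← Cell.wl_wl, ← Cell.map_wl, c_cell,
        cell_unit_transpose, Cell.id_wl]
  -- The comparison `c` thus corresponds under `q` to the transpose of `Q.fst`, whose inverse is
  -- `k`. This is why `k ≫ F q` inverts `c`.
  have hqc : F.map q ≫ c = F.map Q.fst ≫ adj.counitApp C.pt := by
    refine C.hom_ext_of ?_ ?_ ?_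
    · rw [Strict.assoc, c_fst, ← Strict.assoc, ← F.map_comp, q_fst, F.map_comp, Strict.assoc,
        Strict.assoc, counitApp_naturality]
    · rw [Strict.assoc, c_snd, ← F.map_comp, q_snd, Strict.assoc, ← counitApp_naturality,
        ← Strict.assoc, ← F.map_comp, Q.condition, F.map_comp, Strict.assoc,
        map_unitApp_counitApp, Strict.comp_id]
    · rw [← Cell.wl_wl, c_cell, ← Cell.wr_wl, ← Cell.map_wl, q_cell, Cell.map_wl, Cell.wr_wl,
        cell_counitApp_naturality, Cell.wl_wl]
  have hqp : q ≫ p = 𝟙 _ := by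
    refine Q.hom_ext (adj.transpose_injective ?_) ?_
    · rw [Strict.assoc, p_fst, F.map_comp, Strict.assoc, map_unitApp_map_counitApp, hqc,
        Strict.id_comp]
    · rw [Strict.assoc, p_snd, q_snd, Strict.id_comp]
  have hc : c = F.map p ≫ F.map Q.fst ≫ adj.counitApp C.pt := by
    rw [← Strict.assoc, ← F.map_comp, p_fst, map_unitApp_map_counitApp]
  refine ⟨k ≫ F.map q, ?_, ?_⟩
  · change c ≫ k ≫ F.map q = 𝟙 _
    rw [hc, Strict.assoc, ← Strict.assoc _ k, hk', Strict.id_comp, ← F.map_comp, hpq, F.map_id]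
  · change (k ≫ F.map q) ≫ c = 𝟙 _
    rw [Strict.assoc, hqc, hk]

variable {X C}

lemma map_comp_map_snd {Z : LaxComma (F.obj y)} {f : Z ⟶ (adj.commaProj K X).toLax F}
    (hf : LaxComma.Hom.bundledCell f = Cell.id Z.hom) :
    f.map ≫ F.map (adj.commaObj K X).snd = Z.hom :=
  congrArg Cell.src hf

lemma bundledCell_comp_commaCounit {Z : LaxComma (F.obj y)} {f : Z ⟶ (adj.commaProj K X).toLax F}
    (hf : LaxComma.Hom.bundledCell f = Cell.id Z.hom) :
    LaxComma.Hom.bundledCell (f ≫ adj.commaCounit K X) = (adj.commaCounitCell K X).wl f.map := by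
  rw [LaxComma.bundledCell_comp, Cell.vc_eq_left hf, bundledCell_commaCounit]

/-- For a strict target `g`, the condition on a 2-cell `f ⟹ g` of `A // F y` says exactly that its
component over `F y` is the 2-cell of `f`. Hence that component carries no freedom. -/
lemma wr_cell_map_snd {Z : LaxComma (F.obj y)} {f g : Z ⟶ (adj.commaProj K X).toLax F} (θ : f ⟶ g)
    (hg : LaxComma.Hom.bundledCell g = Cell.id Z.hom) :
    (Cell.of θ.cell).wr (F.map (adj.commaObj K X).snd) = LaxComma.Hom.bundledCell f := by
  rw [← LaxComma.Hom₂.bundled_w θ, Cell.vc_eq_left hg]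

variable {d : C.pt ⟶ F.obj (adj.commaObj K X).pt}

/-- Strict morphisms into `(F (G a ↓ η_y), F q)` are determined by their composite with the
counit. -/
lemma hom_ext_of_commaCounit (hd : adj.commaComparison K X C ≫ d = 𝟙 _)
    {Z : LaxComma (F.obj y)} {f g : Z ⟶ (adj.commaProj K X).toLax F}
    (hf : LaxComma.Hom.bundledCell f = Cell.id Z.hom)
    (hg : LaxComma.Hom.bundledCell g = Cell.id Z.hom)
    (h : f ≫ adj.commaCounit K X = g ≫ adj.commaCounit K X) : f = g := by
  -- Both become morphisms into `C` with the same projections and the same 2-cell.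
  have e : f.map ≫ adj.commaComparison K X C = g.map ≫ adj.commaComparison K X C := by
    refine C.hom_ext_of ?_ ?_ ?_
    · rw [Strict.assoc, Strict.assoc, commaComparison_fst]
      exact congrArg LaxComma.Hom.map h
    · rw [Strict.assoc, Strict.assoc, commaComparison_snd, map_comp_map_snd adj K hf,
        map_comp_map_snd adj K hg]
    · rw [← Cell.wl_wl, ← Cell.wl_wl, wl_commaComparison, ← bundledCell_comp_commaCounit adj K hf,
        ← bundledCell_comp_commaCounit adj K hg, h]
  refine LaxComma.hom_ext_of ?_ (hf.trans hg.symm)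
  rw [← Strict.comp_id f.map, ← Strict.comp_id g.map, ← hd, ← Strict.assoc, e, Strict.assoc]

/-- Carried over to `C`, a 2-cell is determined by its two components. Whiskering with the counit
records the first, and strictness of `g` forces the second. -/
lemma whiskerRight_commaCounit_injective (hd : adj.commaComparison K X C ≫ d = 𝟙 _)
    {Z : LaxComma (F.obj y)} {f g : Z ⟶ (adj.commaProj K X).toLax F}
    (hg : LaxComma.Hom.bundledCell g = Cell.id Z.hom) :
    Function.Injective (fun θ : f ⟶ g => θ ▷ adj.commaCounit K X) := by
  intro θ φ h
  have e : (Cell.of θ.cell).wr (adj.commaComparison K X C) =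
      (Cell.of φ.cell).wr (adj.commaComparison K X C) := by
    refine C.cell_ext rfl rfl ?_ ?_
    · rw [Cell.wr_wr, Cell.wr_wr, commaComparison_fst]
      exact congrArg (fun t => Cell.of (LaxComma.Hom₂.cell t)) h
    · rw [Cell.wr_wr, Cell.wr_wr, commaComparison_snd, wr_cell_map_snd adj K _ hg,
        wr_cell_map_snd adj K _ hg]
  refine LaxComma.hom₂_ext (Cell.of_injective ?_)
  rw [← Cell.wr_id (Cell.of θ.cell), ← Cell.wr_id (Cell.of φ.cell), ← hd, ← Cell.wr_wr, e,
    Cell.wr_wr]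

/-- A 2-cell into `C` is built from `ζ` and the 2-cell of `f`. Their compatibility with the
universal 2-cell of `C` is precisely the condition that `ζ` be a 2-cell of `A // F y`. -/
lemma whiskerRight_commaCounit_surjective (hd : adj.commaComparison K X C ≫ d = 𝟙 _)
    (hd' : d ≫ adj.commaComparison K X C = 𝟙 _) {Z : LaxComma (F.obj y)} {f g : Z ⟶ (adj.commaProj K X).toLax F}
    (hg : LaxComma.Hom.bundledCell g = Cell.id Z.hom) :
    Function.Surjective (fun θ : f ⟶ g => θ ▷ adj.commaCounit K X) := by
  intro ζ
  have hζ := LaxComma.Hom₂.bundled_w ζ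
  obtain ⟨ξ, hξ₀, hξ₁⟩ := C.exists_cell (f.map ≫ adj.commaComparison K X C)
    (g.map ≫ adj.commaComparison K X C) (Cell.of ζ.cell) (LaxComma.Hom.bundledCell f)
    (by rw [Strict.assoc, commaComparison_fst]; rfl)
    (by rw [Strict.assoc, commaComparison_fst]; rfl)
    (by rw [Strict.assoc, commaComparison_snd]; rfl)
    (by rw [Strict.assoc, commaComparison_snd, map_comp_map_snd adj K hg]; rfl)
    (by
      rw [← Cell.wl_wl, wl_commaComparison, ← bundledCell_comp_commaCounit adj K hg]; rfl)
    (by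
      rw [← Cell.wl_wl, wl_commaComparison, Cell.wr_id, Cell.wl_tgt, commaCounitCell_tgt]; rfl)
    ((Cell.vc_congr rfl (by
        rw [← Cell.wl_wl, wl_commaComparison, bundledCell_comp_commaCounit adj K hg]) _).trans
      (hζ.trans ((LaxComma.bundledCell_comp _ _).trans (Cell.vc_congr (by
        rw [← Cell.wl_wl, wl_commaComparison, bundledCell_commaCounit]) (Cell.wr_id _).symm _))))
  have hθ : f.map = (f.map ≫ adj.commaComparison K X C) ≫ d := by
    rw [Strict.assoc, hd, Strict.comp_id]
  have hθ' : g.map = (g.map ≫ adj.commaComparison K X C) ≫ d := by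
    rw [Strict.assoc, hd, Strict.comp_id]
  -- Transport back along the inverse `d` of the comparison.
  let θ : f.map ⟶ g.map := ((Cell.of ξ).wr d).cast hθ hθ'
  have hc : Cell.of θ = (Cell.of ξ).wr d := Cell.of_cast _ hθ hθ'
  have hw : (Cell.of θ).wr (F.map (adj.commaObj K X).snd) = LaxComma.Hom.bundledCell f := by
    rw [hc, Cell.wr_wr, ← adj.commaComparison_snd K X C, ← Strict.assoc, hd',
      Strict.id_comp, hξ₁]
  have hm : (Cell.of θ).wr (adj.commaCounitMap K X) = Cell.of ζ.cell := by
    rw [hc, Cell.wr_wr, ← adj.commaComparison_fst K X C, ← Strict.assoc, hd',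
      Strict.id_comp, hξ₀]
  exact ⟨LaxComma.Hom₂.mk θ (LaxComma.hom₂_w ((Cell.vc_eq_left hg _).trans hw)),
    LaxComma.hom₂_ext (Cell.of_injective hm)⟩

/-- The 2-cell of a lax morphism is exactly the datum of a map into the comma object `C`, and that
map lies strictly over `F y`. -/
lemma exists_comp_commaCounit_eq (hd' : d ≫ adj.commaComparison K X C = 𝟙 _) {Z : LaxComma (F.obj y)} (g : Z ⟶ X) :
    ∃ f : Z ⟶ (adj.commaProj K X).toLax F,
      LaxComma.Hom.bundledCell f = Cell.id Z.hom ∧ f ≫ adj.commaCounit K X = g := by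
  let l : Z.left ⟶ C.pt := C.liftCell g.map Z.hom (LaxComma.Hom.bundledCell g) rfl
    (Strict.comp_id _)
  have hl : (l ≫ d) ≫ adj.commaComparison K X C = l := by
    rw [Strict.assoc, hd', Strict.comp_id]
  have l_fst : l ≫ C.fst = g.map := CommaObject.liftCell_fst _ _ _ _ _ _
  have l_snd : l ≫ C.snd = Z.hom := CommaObject.liftCell_snd _ _ _ _ _ _
  have l_cell : C.bundledCell.wl l = LaxComma.Hom.bundledCell g :=
    CommaObject.wl_liftCell_bundledCell _ _ _ _ _ _
  have w : (l ≫ d) ≫ F.map (adj.commaObj K X).snd = Z.hom := by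
    rw [← adj.commaComparison_snd K X C, ← Strict.assoc, hl, l_snd]
  have hf : LaxComma.Hom.bundledCell (LaxComma.Hom.mk (l ≫ d) (eqToHom w) :
      Z ⟶ (adj.commaProj K X).toLax F) = Cell.id Z.hom :=
    (Cell.of_eqToHom w).trans (congrArg Cell.id w)
  refine ⟨_, hf, LaxComma.hom_ext_of ?_ ?_⟩
  · change (l ≫ d) ≫ adj.commaCounitMap K X = g.map
    rw [← adj.commaComparison_fst K X C, ← Strict.assoc, hl, l_fst]
  · rw [bundledCell_comp_commaCounit adj K hf]
    change (adj.commaCounitCell K X).wl (l ≫ d) = _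
    rw [← adj.wl_commaComparison K X C, Cell.wl_wl, hl, l_cell]

end Comparison

/-! ### Lax idempotence and 2-premonadicity of the comma 2-adjunction -/

lemma isPreKockZoberlein_commaAdjunction (h𝒜 : HasCommaObjects A)
    (P : PullbacksAlong (adj.unitApp y))
    (hP : TwoCat.IsFullReflective ((strictCommaLift G (F.obj y)).comp (pullbackBaseChange P))) :
    (adj.commaAdjunction K).IsPreKockZoberlein := by
  have H : ∀ X : LaxComma (F.obj y), ∃ (C : CommaObject X.hom (𝟙 (F.obj y)))
      (d : C.pt ⟶ F.obj (adj.commaObj K X).pt),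
      adj.commaComparison K X C ≫ d = 𝟙 _ ∧ d ≫ adj.commaComparison K X C = 𝟙 _ := fun X => by
    obtain ⟨C⟩ := h𝒜 X.hom (𝟙 (F.obj y))
    exact ⟨C, adj.exists_inv_commaComparison K X C P hP⟩
  refine ⟨isLaxIdempotent_of_bijective _ fun X b h g => ?_,
    isTwoPremonadic_of_split _ fun X => ?_⟩
  · obtain ⟨C, d, hd, hd'⟩ := H X
    have hg : LaxComma.Hom.bundledCell (StrictComma.toLaxMap F g) = _ :=
      StrictComma.bundledCell_toLaxMap F g
    exact ⟨adj.whiskerRight_commaCounit_injective K hd hg,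
      adj.whiskerRight_commaCounit_surjective K hd hd' hg⟩
  · obtain ⟨C, d, hd, hd'⟩ := H X
    obtain ⟨C', d', -, hd₁'⟩ := H ((adj.commaProj K X).toLax F)
    -- The section of the counit is the strict morphism classifying the identity of `X`, and `t` is
    -- the strict morphism classifying `ε ≫ s`.
    obtain ⟨s, hs, hs'⟩ := adj.exists_comp_commaCounit_eq K hd' (𝟙 X)
    obtain ⟨t, ht, ht'⟩ := adj.exists_comp_commaCounit_eq K hd₁' (adj.commaCounit K X ≫ s)
    refine ⟨s, t, hs', ?_, ht'⟩
    change t ≫ StrictComma.toLaxMap F (adj.commaProjMap K (adj.commaCounit K X)) = 𝟙 _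
    -- Both sides are strict, so it suffices to compare composites with the counit: naturality gives
    -- `t ≫ ε ≫ ε = ε ≫ s ≫ ε = ε`.
    refine adj.hom_ext_of_commaCounit K hd ?_ ?_ ?_
    · rw [LaxComma.bundledCell_comp, Cell.vc_eq_left ht, StrictComma.bundledCell_toLaxMap,
        Cell.wl_id, map_comp_map_snd adj K ht]
    · rw [LaxComma.bundledCell_id]
    · rw [Strict.assoc, commaCounit_naturality, ← Strict.assoc, ht', Strict.assoc, hs',
        Strict.comp_id, Strict.id_comp]

end TwoAdjunction
end TwoCat

theorem mainTheorem1
    {𝒜 : Type u} [Bicategory.{w, v} 𝒜] [Bicategory.Strict 𝒜]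
    {ℬ : Type u₁} [Bicategory.{w₁, v₁} ℬ] [Bicategory.Strict ℬ]
    {F : StrictPseudofunctor ℬ 𝒜} {G : StrictPseudofunctor 𝒜 ℬ}
    (adj : TwoCat.TwoAdjunction F G)
    (h𝒜 : TwoCat.HasCommaObjects 𝒜)
    (P : ∀ y : ℬ, TwoCat.PullbacksAlong (adj.unitApp y))
    (K : ∀ y : ℬ, TwoCat.CommaObjectsAlong (adj.unitApp y))
    (hadm : adj.IsAdmissible P) :
    adj.IsTwoAdmissible K :=
  ⟨adj.isPreKockZoberlein_of_isFullyFaithful hadm.1, fun y =>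
    ⟨_, adj.commaAdjunction (K y),
      adj.isPreKockZoberlein_commaAdjunction (K y) h𝒜 (P y) (hadm.2 y)⟩⟩
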